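/- Let $x_1,\dots,x_n\in\mathbb R^d$ be distinct and $y_1,\dots,y_m\in\mathbb R^d$ be distinct, and let $a_i,b_j>0$ with $\sum_{i=1}^n a_i=\sum_{j=1}^m b_j=1$. Let $\gamma$ be a probability measure on $\mathbb R^d\times\mathbb R^d$ with a continuous bounded density $\rho\ge 0$ with respect to Lebesgue measure. For $\alpha\in\mathbb R^n$, $\beta\in\mathbb R^m$ put $f(x,\alpha)=\max_{1\le i\le n}\{\langle x,x_i\rangle+\alpha_i\}$, $g(y,\beta)=\max_{1\le j\le m}\{\langle y,y_j\rangle+\beta_j\}$, $A_i(\alpha)=\{x: f(x,\alpha)=\langle x,x_i\rangle+\alpha_i\}$, $B_j(\beta)=\{y: g(y,\beta)=\langle y,y_j\rangle+\beta_j\}$, $W_{\alpha,\beta}(x,y)=\exp\bigl(f(x,\alpha)+g(y,\beta)-\tfrac12\|x\|^2-\tfrac12\|y\|^2\bigr)$, and $$U(\alpha,\beta)=\sum_{i=1}^n a_i\Bigl(\alpha_i+\tfrac12\|x_i\|^2\Bigr)+\sum_{j=1}^m b_j\Bigl(\beta_j+\tfrac12\|y_j\|^2\Bigr)-\int W_{\alpha,\beta}\,d\gamma+1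 .$$ A maximizer of $U$ over $\mathbb R^{n+m}$ is called a dual optimizer. Write $(\alpha,\beta)\sim_\oplus(\alpha',\beta')$ if there is $r\in\mathbb R$ with $\alpha=\alpha'+r\mathbf 1$ and $\beta=\beta'-r\mathbf 1$. Then $U$ is differentiable on $\mathbb R^{n+m}$, with $$\partial_{\alpha_i}U(\alpha,\beta)=a_i-\int_{A_i(\alpha)\times\mathbb R^d}W_{\alpha,\beta}\,d\gamma,\qquad \partial_{\beta_j}U(\alpha,\beta)=b_j-\int_{\mathbb R^d\times B_j(\beta)}W_{\alpha,\beta}\,d\gamma .$$ Moreover, for every initial point $(\alpha^0,\beta^0)\in\mathbb R^{n+m}$ there is $\eta_0>0$ such that for every step size $0<\eta<\eta_0$ the gradient ascent iterates $$(\alpha^{t+1},\beta^{t+1})=(\alpha^t,\beta^t)+\eta\,\nabla U(\alpha^t,\beta^t),\qquad t\ge 0,$$ converge in $\mathbb R^{n+m}$, and their limit $(\alpha^\infty,\beta^\infty)$ is a dual optimizer. If in addition the set $\{\rho>0\}$ is connected (for instance, if $\rho>0$ everywhere), the limit is the dual optimizer up to $\sim_\oplus$: $(\alpha^\infty,\beta^\infty)\sim_\oplus(\alpha^*,\beta^*)$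 for every dual optimizer $(\alpha^*,\beta^*)$. -/

import Mathlib

open MeasureTheory Filter Topology
open scoped Gradient

noncomputable section

namespace RelaxedBridge

/-- The space `ℝ^{n+m}` of dual variables, with its Euclidean structure. A point `z` is the pair
`(α, β)` with `α i = z (Sum.inl i)` and `β j = z (Sum.inr j)`. -/
abbrev Dual (n m : ℕ) : Type := EuclideanSpace ℝ (Fin n ⊕ Fin m)

/-- The component `α ∈ ℝ^n` of `(α, β)`. -/
def fstPart {n m : ℕ} (z : Dual n m) : Fin n → ℝ := fun i => z (Sum.inl i)

/-- The component `β ∈ ℝ^m` of `(α, β)`. -/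
def sndPart {n m : ℕ} (z : Dual n m) : Fin m → ℝ := fun j => z (Sum.inr j)

/-- The max-affine function `u ↦ max_i (⟨u, p i⟩ + c i)`. With `p = x`, `c = α` it is `f(·, α)`,
and with `p = y`, `c = β` it is `g(·, β)`. -/
def maxAffine {d k : ℕ} (p : Fin k → EuclideanSpace ℝ (Fin d)) (c : Fin k → ℝ)
    (u : EuclideanSpace ℝ (Fin d)) : ℝ :=
  ⨆ i, (inner ℝ u (p i) + c i)

/-- The Laguerre cell of index `i`: the set where the affine function of index `i` attains the
maximum. With `p = x`, `c = α` it is `A_i(α)`, and with `p = y`, `c = β` it is `B_i(β)`. -/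
def laguerreCell {d k : ℕ} (p : Fin k → EuclideanSpace ℝ (Fin d)) (c : Fin k → ℝ) (i : Fin k) :
    Set (EuclideanSpace ℝ (Fin d)) :=
  {u | maxAffine p c u = inner ℝ u (p i) + c i}

/-- The weight `exp (f(x, α) + g(y, β) - ‖x‖² / 2 - ‖y‖² / 2)` at the point `w = (x, y)`. -/
def weight {d n m : ℕ} (x : Fin n → EuclideanSpace ℝ (Fin d)) (y : Fin m → EuclideanSpace ℝ (Fin d))
    (z : Dual n m) (w : EuclideanSpace ℝ (Fin d) × EuclideanSpace ℝ (Fin d)) : ℝ :=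
  Real.exp (maxAffine x (fstPart z) w.1 + maxAffine y (sndPart z) w.2
    - 1 / 2 * ‖w.1‖ ^ 2 - 1 / 2 * ‖w.2‖ ^ 2)

/-- The dual objective `U(α, β)` of the transport-relaxed Schrödinger bridge with marginals
`μ = ∑ a i δ_{x i}`, `ν = ∑ b j δ_{y j}` and reference measure `γ`. -/
def dualObjective {d n m : ℕ} (a : Fin n → ℝ) (x : Fin n → EuclideanSpace ℝ (Fin d))
    (b : Fin m → ℝ) (y : Fin m → EuclideanSpace ℝ (Fin d))
    (γ : Measure (EuclideanSpace ℝ (Fin d) × EuclideanSpace ℝ (Fin d))) (z : Dual n m) : ℝ :=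
  ∑ i, a i * (fstPart z i + 1 / 2 * ‖x i‖ ^ 2) + ∑ j, b j * (sndPart z j + 1 / 2 * ‖y j‖ ^ 2)
    - ∫ w, weight x y z w ∂γ + 1

/-- The explicit expression for the gradient of `U`: its entries are
`a i - ∫_{A_i(α) × ℝ^d} weight dγ` and `b j - ∫_{ℝ^d × B_j(β)} weight dγ`. -/
def dualGradient {d n m : ℕ} (a : Fin n → ℝ) (x : Fin n → EuclideanSpace ℝ (Fin d))
    (b : Fin m → ℝ) (y : Fin m → EuclideanSpace ℝ (Fin d))
    (γ : Measure (EuclideanSpace ℝ (Fin d) × EuclideanSpace ℝ (Fin d))) (z : Dual n m) :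
    Dual n m :=
  WithLp.toLp 2 (Sum.elim
    (fun i => a i - ∫ w in laguerreCell x (fstPart z) i ×ˢ Set.univ, weight x y z w ∂γ)
    (fun j => b j - ∫ w in Set.univ ×ˢ laguerreCell y (sndPart z) j, weight x y z w ∂γ))

/-- Gradient ascent on `F` with step size `η`, started at `z₀`. -/
def gradientAscent {n m : ℕ} (F : Dual n m → ℝ) (η : ℝ) (z₀ : Dual n m) : ℕ → Dual n m
  | 0 => z₀
  | t + 1 => gradientAscent F η z₀ t + η • ∇ F (gradientAscent F η z₀ t)

/-- The relation `(α, β) ∼ (α', β')`: for some `r ∈ ℝ`, `α = α' + r 1` and `β = β' - r 1`. -/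
def ShiftEquiv {n m : ℕ} (z z' : Dual n m) : Prop :=
  ∃ r : ℝ, (∀ i, fstPart z i = fstPart z' i + r) ∧ ∀ j, sndPart z j = sndPart z' j - r

end RelaxedBridge

end

/-! For fixed `w` the logarithm of the weight is a convex piecewise affine function of the dual
variable `z`, so the weight is convex in `z` and `U` is concave. Kinks occur only at ties between
two affine pieces. As the points are distinct, ties lie on finitely many hyperplanes, and since `ρ`
is bounded the Gaussian-weighted mass of a tie slab of width `s` is `O(s)`, uniformly in `z`
(`exists_setLIntegral_tieSet_le`). An increment `h` costs a first-order error only on a slab of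
width `2‖h‖` and a second-order error elsewhere, so the integrated error is `O(‖h‖²)`, locally
uniformly in `z` (`exists_abs_integral_weightError_le`). This gives both the gradient formula and a
local smoothness constant.

Ascent on `U` is descent on the convex function `-U` (`exists_tendsto_gradientDescent`). `U` is
invariant under the shift `(1, -1)`, hence not coercive, but its gradient is orthogonal to that
vector: the iterates stay in one affine hyperplane, where superlevel sets are bounded
(`isBounded_superlevel`). The sequence is Fejér monotone, so one cluster point forces full
convergence.

If two points are optimal, equality in the convexity inequality makes `f + g` agree at both, first
almost everywhere and then on `{ρ > 0}` by continuity. There a function of the first component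
equals a function of the second, hence is a constant `r` by connectedness. Every cell of an
optimizer carries mass `a i` or `b j`, so it meets `{ρ > 0}`, and comparing affine pieces there
gives the shift by `r`. -/

noncomputable section

namespace RelaxedBridge

/-! ### Convergence of gradient descent for convex functions -/

/-- Gradient descent with a small constant step on a function `F` that lies above its linearizations
and locally below quadratic models, when the gradient is orthogonal to a fixed vector `e` and the
sublevel sets are bounded on the hyperplanes orthogonal to `e`. -/
theorem exists_tendsto_gradientDescent {V : Type*} [NormedAddCommGroup V] [InnerProductSpace ℝ V]
    [ProperSpace V] {F : V → ℝ} {G : V → V} {e : V} (hcont : Continuous F)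
    (hsub : ∀ z h, F z + inner ℝ (G z) h ≤ F (z + h))
    (hsmooth : ∀ R : ℝ, ∃ L : ℝ, ∀ z h, ‖z‖ ≤ R → ‖h‖ ≤ 1 / 2 →
      F (z + h) ≤ F z + inner ℝ (G z) h + L * ‖h‖ ^ 2)
    (horth : ∀ z, inner ℝ e (G z) = 0)
    (hbdd : ∀ s c : ℝ, Bornology.IsBounded {z | inner ℝ e z = s ∧ F z ≤ c}) (z₀ : V) :
    ∃ η₀ : ℝ, 0 < η₀ ∧ ∀ η : ℝ, 0 < η → η < η₀ → ∀ u : ℕ → V, u 0 = z₀ →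
      (∀ t, u (t + 1) = u t - η • G (u t)) →
      ∃ zl, Tendsto u atTop (𝓝 zl) ∧ ∀ z, F zl ≤ F z := by
  obtain ⟨R, hR⟩ := (hbdd (inner ℝ e z₀) (F z₀)).exists_norm_le
  set S := {z | inner ℝ e z = inner ℝ e z₀ ∧ F z ≤ F z₀} with hS
  obtain ⟨L₀, hL₀⟩ := hsmooth R
  set L := max L₀ 1
  have hL1 : 1 ≤ L := le_max_right _ _
  have hL : ∀ z h, ‖z‖ ≤ R → ‖h‖ ≤ 1 / 2 →
      F (z + h) ≤ F z + inner ℝ (G z) h + L * ‖h‖ ^ 2 := fun z h hz hh =>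
    (hL₀ z h hz hh).trans (by gcongr; exact le_max_left _ _)
  obtain ⟨B, hB⟩ := (isCompact_closedBall (0 : V) (R + 1)).exists_bound_of_continuousOn
    hcont.continuousOn
  have hB' : ∀ z, ‖z‖ ≤ R + 1 → |F z| ≤ B := fun z hz => hB z (by simpa using hz)
  have hz₀S : z₀ ∈ S := ⟨rfl, le_rfl⟩
  have hB0 : 0 ≤ B := (abs_nonneg _).trans (hB' z₀ (by linarith [hR z₀ hz₀S]))
  -- The subgradient inequality along the unit vector in direction `G z` bounds `‖G z‖` by the
  -- oscillation of `F` on the ball of radius `R + 1`. The extra `1` keeps the step size well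
  -- defined when `B = 0`.
  have hG : ∀ z ∈ S, ‖G z‖ ≤ 2 * B + 1 := by
    intro z hz
    by_cases h0 : G z = 0
    · rw [h0, norm_zero]; positivity
    have hpos : 0 < ‖G z‖ := norm_pos_iff.2 h0
    have hn : ‖‖G z‖⁻¹ • G z‖ = 1 := by
      rw [norm_smul, norm_inv, norm_norm, inv_mul_cancel₀ hpos.ne']
    have h1 := hsub z (‖G z‖⁻¹ • G z)
    rw [inner_smul_right, real_inner_self_eq_norm_sq, sq, ← mul_assoc,
      inv_mul_cancel₀ hpos.ne', one_mul] at h1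
    have h2 := abs_le.1 (hB' z (by linarith [hR z hz]))
    have h3 := abs_le.1 (hB' (z + ‖G z‖⁻¹ • G z)
      ((norm_add_le _ _).trans (by rw [hn]; linarith [hR z hz])))
    linarith [h2.1, h3.2]
  -- The first bound keeps each step of length at most `1 / 2`, where the quadratic model is valid;
  -- the second makes `η * L ≤ 1 / 2`, so a step decreases `F` by at least `η / 2 * ‖G z‖ ^ 2`.
  refine ⟨min (1 / (2 * (2 * B + 1))) (1 / (2 * L)), by positivity, ?_⟩
  intro η hη hη₀ u hu0 hu
  have hηB : η * (2 * B + 1) ≤ 1 / 2 := by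
    have := (hη₀.trans_le (min_le_left _ _)).le
    rw [le_div_iff₀ (by positivity)] at this
    linarith
  have hηL : η * L ≤ 1 / 2 := by
    have := (hη₀.trans_le (min_le_right _ _)).le
    rw [le_div_iff₀ (by positivity)] at this
    linarith
  have hstep : ∀ z ∈ S, F (z - η • G z) ≤ F z - η / 2 * ‖G z‖ ^ 2 := by
    intro z hz
    have hn : ‖-(η • G z)‖ = η * ‖G z‖ := by
      rw [norm_neg, norm_smul, Real.norm_of_nonneg hη.le]
    have h1 := hL z (-(η • G z)) (hR z hz) (by
      rw [hn]; exact (mul_le_mul_of_nonneg_left (hG z hz) hη.le).trans hηB)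
    rw [hn, inner_neg_right, inner_smul_right, real_inner_self_eq_norm_sq, ← sub_eq_add_neg] at h1
    have h2 : η * L * (η * ‖G z‖ ^ 2) ≤ 1 / 2 * (η * ‖G z‖ ^ 2) := by gcongr
    nlinarith
  have huS : ∀ t, u t ∈ S := by
    intro t
    induction t with
    | zero => rw [hu0]; exact hz₀S
    | succ t ih =>
      rw [hu]
      refine ⟨?_, ?_⟩
      · rw [inner_sub_right, inner_smul_right, horth, mul_zero, sub_zero]; exact ih.1
      · have := hstep _ ih
        have : 0 ≤ η / 2 * ‖G (u t)‖ ^ 2 := by positivity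
        linarith [ih.2]
  have hdec : ∀ t, η / 2 * ‖G (u t)‖ ^ 2 ≤ F (u t) - F (u (t + 1)) := fun t => by
    have := hstep _ (huS t)
    rw [hu]; linarith
  have hanti : Antitone fun t => F (u t) := antitone_nat_of_succ_le fun t => by
    have := hdec t
    have : 0 ≤ η / 2 * ‖G (u t)‖ ^ 2 := by positivity
    linarith
  have hlim := tendsto_atTop_ciInf hanti ⟨-B, by
    rintro _ ⟨t, rfl⟩
    exact (abs_le.1 (hB' (u t) (by linarith [hR _ (huS t)]))).1⟩
  have hGsq : Tendsto (fun t => ‖G (u t)‖ ^ 2) atTop (𝓝 0) := by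
    have h1 : Tendsto (fun t => 2 / η * (F (u t) - F (u (t + 1)))) atTop (𝓝 0) := by
      simpa using (hlim.sub (hlim.comp (tendsto_add_atTop_nat 1))).const_mul (2 / η)
    refine squeeze_zero (fun _ => by positivity) (fun t => ?_) h1
    have := mul_le_mul_of_nonneg_left (hdec t) (by positivity : 0 ≤ 2 / η)
    calc _ = 2 / η * (η / 2 * ‖G (u t)‖ ^ 2) := by field_simp
      _ ≤ _ := this
  have hG0 : Tendsto (fun t => G (u t)) atTop (𝓝 0) := by
    rw [tendsto_zero_iff_norm_tendsto_zero]
    simpa [Real.sqrt_sq] using hGsq.sqrt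
  obtain ⟨zl, -, φ, hφ, hzl⟩ := (isCompact_closedBall (0 : V) R).tendsto_subseq
    (x := u) fun t => by simpa using hR _ (huS t)
  -- Pass to the limit in the affine minorants of `F` at the iterates, whose slopes tend to `0`.
  have hmin : ∀ z, F zl ≤ F z := by
    intro z
    have h1 : Tendsto (fun t => F (u (φ t)) + inner ℝ (G (u (φ t))) (z - u (φ t))) atTop
        (𝓝 (F zl + inner ℝ (0 : V) (z - zl))) :=
      ((hcont.tendsto zl).comp hzl).add
        ((hG0.comp hφ.tendsto_atTop).inner (tendsto_const_nhds.sub hzl))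
    rw [inner_zero_left, add_zero] at h1
    refine le_of_tendsto' h1 fun t => ?_
    simpa using hsub (u (φ t)) (z - u (φ t))
  -- Expanding the square, the cross term is at most `2η (F zl - F (u t))` by convexity and the
  -- quadratic term at most `2η (F (u t) - F (u (t + 1)))` by descent. Their sum is nonpositive
  -- because `zl` is a minimizer.
  have hfejer : Antitone fun t => ‖u t - zl‖ := antitone_nat_of_succ_le fun t => by
    have h1 := hsub (u t) (zl - u t)
    rw [add_sub_cancel] at h1
    have h2 : inner ℝ (u t - zl) (η • G (u t)) = - (η * inner ℝ (G (u t)) (zl - u t)) := by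
      rw [inner_smul_right, real_inner_comm, ← neg_sub zl (u t), inner_neg_right]; ring
    have h3 : ‖u (t + 1) - zl‖ ^ 2 ≤ ‖u t - zl‖ ^ 2 := by
      have : u (t + 1) - zl = (u t - zl) - η • G (u t) := by rw [hu]; abel
      rw [this, norm_sub_sq_real, h2, norm_smul, Real.norm_of_nonneg hη.le, mul_pow]
      have h4 := hdec t
      have h5 := hmin (u (t + 1))
      nlinarith
    exact le_of_sq_le_sq h3 (norm_nonneg _)
  refine ⟨zl, ?_, hmin⟩
  rw [Metric.tendsto_atTop]
  intro ε hε
  obtain ⟨N, hN⟩ := Metric.tendsto_atTop.1 hzl ε hε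
  refine ⟨φ N, fun t ht => ?_⟩
  have h1 := hN N le_rfl
  rw [Function.comp_apply, dist_eq_norm] at h1
  rw [dist_eq_norm]
  exact (hfejer ht).trans_lt h1

/-! ### Mass of slabs and of neighbourhoods of ties -/

/-- The mass of a slab `{|φ - c| ≤ s}` is at most linear in its width, for a weight `g` whose
translates along `v` are dominated by `H`. -/
theorem setLIntegral_slab_le {V : Type*} [NormedAddCommGroup V] [NormedSpace ℝ V]
    [MeasurableSpace V] [BorelSpace V] [SecondCountableTopology V] (μ : Measure V) [SFinite μ]
    [μ.IsAddRightInvariant] (φ : V →L[ℝ] ℝ) {v : V} (hv : 0 < φ v) {g H : V → ENNReal}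
    (hH : Measurable H) (hgH : ∀ w, ∀ t ∈ Set.Icc (0 : ℝ) 1, g (w + t • v) ≤ H w)
    (c s : ℝ) :
    ∫⁻ w in {w | |φ w - c| ≤ s}, g w ∂μ ≤ ENNReal.ofReal (2 * s / φ v) * ∫⁻ w, H w ∂μ := by
  set S : Set V := {w | |φ w - c| ≤ s} with hS_def
  have hS : MeasurableSet S := by
    apply measurableSet_le <;> fun_prop
  have hind : Measurable fun p : ℝ × V => S.indicator (1 : V → ENNReal) (p.2 + p.1 • v) :=
    (measurable_one.indicator hS).comp (by fun_prop)
  -- A line in direction `v` crosses the slab in a time interval of length `2 * s / φ v`.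
  have hline : ∀ w : V, ∫⁻ t in Set.Icc (0 : ℝ) 1, S.indicator (1 : V → ENNReal) (w + t • v)
      ≤ ENNReal.ofReal (2 * s / φ v) := by
    intro w
    have hsub : ∀ t : ℝ, S.indicator (1 : V → ENNReal) (w + t • v) ≤
        (Set.Icc ((c - s - φ w) / φ v) ((c + s - φ w) / φ v)).indicator 1 t := by
      intro t
      by_cases ht : w + t • v ∈ S
      · have h1 : |φ w + t * φ v - c| ≤ s := by
          simpa only [hS_def, Set.mem_ofPred_eq, map_add, map_smul, smul_eq_mul] using ht
        rw [abs_le] at h1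
        have h2 : t ∈ Set.Icc ((c - s - φ w) / φ v) ((c + s - φ w) / φ v) := by
          rw [Set.mem_Icc, div_le_iff₀ hv, le_div_iff₀ hv]
          constructor <;> linarith [h1.1, h1.2]
        simp [ht, h2]
      · simp [ht]
    calc _ ≤ ∫⁻ t : ℝ, S.indicator (1 : V → ENNReal) (w + t • v) := setLIntegral_le_lintegral _ _
      _ ≤ ∫⁻ t : ℝ, (Set.Icc ((c - s - φ w) / φ v) ((c + s - φ w) / φ v)).indicator 1 t :=
        lintegral_mono hsub
      _ = _ := by
        rw [lintegral_indicator_one measurableSet_Icc, Real.volume_Icc]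
        congr 1; ring
  -- By translation invariance the integral equals its average over the shifts by `t • v`, `t ∈ [0,
  -- 1]`. Exchanging the integrals leaves the crossing time of each line.
  calc ∫⁻ w in S, g w ∂μ = ∫⁻ w, S.indicator g w ∂μ := (lintegral_indicator hS _).symm
    _ = ∫⁻ _t in Set.Icc (0 : ℝ) 1, ∫⁻ w, S.indicator g w ∂μ := by simp
    _ = ∫⁻ t in Set.Icc (0 : ℝ) 1, ∫⁻ w, S.indicator g (w + t • v) ∂μ := by
      refine lintegral_congr fun t => (lintegral_add_right_eq_self _ _).symm
    _ ≤ ∫⁻ t in Set.Icc (0 : ℝ) 1, ∫⁻ w, S.indicator 1 (w + t • v) * H w ∂μ := by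
      refine setLIntegral_mono' measurableSet_Icc fun t ht => lintegral_mono fun w => ?_
      by_cases hw : w + t • v ∈ S
      · simpa [hw] using hgH w t ht
      · simp [hw]
    _ = ∫⁻ w, (∫⁻ t in Set.Icc (0 : ℝ) 1, S.indicator 1 (w + t • v) * H w) ∂μ := by
      refine lintegral_lintegral_swap ?_
      exact (hind.mul (hH.comp measurable_snd)).aemeasurable
    _ ≤ ∫⁻ w, ENNReal.ofReal (2 * s / φ v) * H w ∂μ := by
      refine lintegral_mono fun w => ?_
      rw [lintegral_mul_const]
      · gcongr; exact hline w
      · exact hind.comp (measurable_id.prodMk measurable_const)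
    _ = _ := lintegral_const_mul _ hH

section TieSlab

variable {d : ℕ}

/-- The Gaussian weight `exp (-(‖x‖² + ‖y‖²) / 4)` at `(x, y)`. -/
def gaussWeight (w : EuclideanSpace ℝ (Fin d) × EuclideanSpace ℝ (Fin d)) : ℝ :=
  Real.exp (-(1 / 4) * (‖w.1‖ ^ 2 + ‖w.2‖ ^ 2))

theorem continuous_gaussWeight : Continuous (gaussWeight (d := d)) := by
  unfold gaussWeight; fun_prop

theorem gaussWeight_pos (w : EuclideanSpace ℝ (Fin d) × EuclideanSpace ℝ (Fin d)) :
    0 < gaussWeight w := Real.exp_pos _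

theorem gaussWeight_le_one (w : EuclideanSpace ℝ (Fin d) × EuclideanSpace ℝ (Fin d)) :
    gaussWeight w ≤ 1 := by
  rw [gaussWeight, Real.exp_le_one_iff]
  have : 0 ≤ ‖w.1‖ ^ 2 + ‖w.2‖ ^ 2 := by positivity
  linarith

/-- The set of points where two of the affine functions `⟨·, p i⟩ + c i` differ by at most `s`. -/
def tieSlab {k : ℕ} (p : Fin k → EuclideanSpace ℝ (Fin d)) (c : Fin k → ℝ) (s : ℝ) :
    Set (EuclideanSpace ℝ (Fin d)) :=
  {u | ∃ i j, i ≠ j ∧ |inner ℝ (p i - p j) u - (c j - c i)| ≤ s}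

theorem tieSlab_eq_iUnion {k : ℕ} (p : Fin k → EuclideanSpace ℝ (Fin d)) (c : Fin k → ℝ)
    (s : ℝ) : tieSlab p c s = ⋃ q : {q : Fin k × Fin k // q.1 ≠ q.2},
      {u | |inner ℝ (p q.1.1 - p q.1.2) u - (c q.1.2 - c q.1.1)| ≤ s} := by
  ext u; simp [tieSlab]

theorem measurableSet_tieSlab {k : ℕ} (p : Fin k → EuclideanSpace ℝ (Fin d)) (c : Fin k → ℝ)
    (s : ℝ) : MeasurableSet (tieSlab p c s) := by
  rw [tieSlab_eq_iUnion]
  refine MeasurableSet.iUnion fun q => ?_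
  apply measurableSet_le <;> fun_prop

theorem integrable_exp_neg_mul_sq_norm {b : ℝ} (hb : 0 < b) :
    Integrable fun u : EuclideanSpace ℝ (Fin d) => Real.exp (-b * ‖u‖ ^ 2) := by
  have h := (GaussianFourier.integrable_cexp_neg_mul_sq_norm_add (b := (b : ℂ))
    (V := EuclideanSpace ℝ (Fin d)) (by simpa) 0 0).norm
  refine h.congr (Eventually.of_forall fun u => ?_)
  simp only [Complex.norm_exp]
  congr 1
  simp [← Complex.ofReal_pow, ← Complex.ofReal_mul]

/-- Averaging over translates needs an integrable function dominating all of them, and a Gaussian of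
half the exponent serves. `K` depends on `φ` but not on the offset `c`; later `c` varies with the
dual variable. -/
theorem exists_volume_slab_le
    (φ : EuclideanSpace ℝ (Fin d) × EuclideanSpace ℝ (Fin d) →L[ℝ] ℝ) (hφ : φ ≠ 0) :
    ∃ K : ℝ, 0 ≤ K ∧ ∀ c s : ℝ, 0 ≤ s →
      ∫⁻ w in {w | |φ w - c| ≤ s}, ENNReal.ofReal (gaussWeight w) ≤ ENNReal.ofReal (K * s) := by
  obtain ⟨v, hv⟩ : ∃ v, 0 < φ v := by
    obtain ⟨v, hv⟩ : ∃ v, φ v ≠ 0 := by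
      by_contra! h
      exact hφ (ContinuousLinearMap.ext h)
    rcases lt_or_gt_of_ne hv with h | h
    · exact ⟨-v, by simpa using h⟩
    · exact ⟨v, h⟩
  set H : EuclideanSpace ℝ (Fin d) × EuclideanSpace ℝ (Fin d) → ℝ := fun w =>
    Real.exp (1 / 4 * (‖v.1‖ ^ 2 + ‖v.2‖ ^ 2)) *
      (Real.exp (-(1 / 8) * ‖w.1‖ ^ 2) * Real.exp (-(1 / 8) * ‖w.2‖ ^ 2)) with hH
  have hHint : Integrable H :=
    ((integrable_exp_neg_mul_sq_norm (by norm_num : (0 : ℝ) < 1 / 8)).mul_prod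
      (integrable_exp_neg_mul_sq_norm (by norm_num : (0 : ℝ) < 1 / 8))).const_mul _
  -- This is `‖u‖² ≤ 2‖u + t • e‖² + 2‖e‖²`, divided by `8`.
  have key : ∀ (u e : EuclideanSpace ℝ (Fin d)) (t : ℝ), t ∈ Set.Icc (0 : ℝ) 1 →
      -(1 / 4) * ‖u + t • e‖ ^ 2 ≤ 1 / 4 * ‖e‖ ^ 2 + -(1 / 8) * ‖u‖ ^ 2 := by
    intro u e t ht
    have h1 : ‖u‖ ≤ ‖u + t • e‖ + ‖e‖ := by
      have h2 : ‖t • e‖ ≤ ‖e‖ := by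
        rw [norm_smul, Real.norm_of_nonneg ht.1]
        exact mul_le_of_le_one_left (norm_nonneg _) ht.2
      have h3 := norm_sub_le (u + t • e) (t • e)
      rw [add_sub_cancel_right] at h3
      linarith
    have h4 : ‖u‖ ^ 2 ≤ (‖u + t • e‖ + ‖e‖) ^ 2 := by gcongr
    nlinarith [sq_nonneg (‖u + t • e‖ - ‖e‖)]
  have hle : ∀ w, ∀ t ∈ Set.Icc (0 : ℝ) 1, gaussWeight (w + t • v) ≤ H w := by
    intro w t ht
    rw [hH, gaussWeight]
    simp only
    rw [← Real.exp_add, ← Real.exp_add, Real.exp_le_exp]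
    have h1 := key w.1 v.1 t ht
    have h2 := key w.2 v.2 t ht
    simp only [Prod.fst_add, Prod.snd_add, Prod.smul_fst, Prod.smul_snd]
    linarith
  refine ⟨2 / φ v * ∫ w, H w, mul_nonneg (by positivity) (integral_nonneg fun w => by positivity),
    fun c s hs => ?_⟩
  have : (volume : Measure
      (EuclideanSpace ℝ (Fin d) × EuclideanSpace ℝ (Fin d))).IsAddLeftInvariant := by
    rw [Measure.volume_eq_prod]; infer_instance
  have h := setLIntegral_slab_le volume φ hv (g := fun w => ENNReal.ofReal (gaussWeight w))
    (H := fun w => ENNReal.ofReal (H w)) (by fun_prop)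
    (fun w t ht => ENNReal.ofReal_le_ofReal (hle w t ht)) c s
  refine h.trans (le_of_eq ?_)
  rw [← ofReal_integral_eq_lintegral_ofReal hHint (Eventually.of_forall fun w => by positivity),
    ← ENNReal.ofReal_mul (by positivity)]
  congr 1; ring

/-- For distinct points `p i`, the Gaussian mass of the set of `w` with `π w` in a tie slab is at
most linear in its width. -/
theorem exists_setLIntegral_tieSlab_le
    {γ : Measure (EuclideanSpace ℝ (Fin d) × EuclideanSpace ℝ (Fin d))}
    {ρ : EuclideanSpace ℝ (Fin d) × EuclideanSpace ℝ (Fin d) → ℝ} (hρ : Measurable ρ)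
    (hρ_bdd : ∃ C, ∀ w, ρ w ≤ C)
    (hγ : γ = volume.withDensity (fun w => ENNReal.ofReal (ρ w)))
    (π : EuclideanSpace ℝ (Fin d) × EuclideanSpace ℝ (Fin d) →L[ℝ] EuclideanSpace ℝ (Fin d))
    (hπ : Function.Surjective π) {k : ℕ} {p : Fin k → EuclideanSpace ℝ (Fin d)}
    (hp : Function.Injective p) :
    ∃ K : ℝ, 0 ≤ K ∧ ∀ (c : Fin k → ℝ) (s : ℝ), 0 ≤ s →
      ∫⁻ w in π ⁻¹' tieSlab p c s, ENNReal.ofReal (gaussWeight w) ∂γ ≤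
        ENNReal.ofReal (K * s) := by
  obtain ⟨C, hC⟩ := hρ_bdd
  have hK : ∀ q : {q : Fin k × Fin k // q.1 ≠ q.2}, ∃ K : ℝ, 0 ≤ K ∧ ∀ c s : ℝ, 0 ≤ s →
      ∫⁻ w in {w | |inner ℝ (p q.1.1 - p q.1.2) (π w) - c| ≤ s},
        ENNReal.ofReal (gaussWeight w) ≤ ENNReal.ofReal (K * s) := by
    intro q
    refine exists_volume_slab_le ((innerSL ℝ (p q.1.1 - p q.1.2)).comp π) fun h => ?_
    obtain ⟨w, hw⟩ := hπ (p q.1.1 - p q.1.2)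
    have h1 := congrArg (fun f => f w) h
    simp only [ContinuousLinearMap.comp_apply, hw, innerSL_apply_apply,
      zero_apply, inner_self_eq_zero, sub_eq_zero] at h1
    exact q.2 (hp h1)
  choose K hK0 hK using hK
  refine ⟨max C 0 * ∑ q, K q, mul_nonneg (le_max_right _ _)
    (Finset.sum_nonneg fun q _ => hK0 q), fun c s hs => ?_⟩
  have hmeas : ∀ q : {q : Fin k × Fin k // q.1 ≠ q.2}, MeasurableSet
      {w | |inner ℝ (p q.1.1 - p q.1.2) (π w) - (c q.1.2 - c q.1.1)| ≤ s} := fun q => by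
    apply measurableSet_le <;> fun_prop
  rw [tieSlab_eq_iUnion, Set.preimage_iUnion]
  refine (lintegral_iUnion_le _ _).trans ?_
  rw [tsum_fintype, Finset.mul_sum, Finset.sum_mul, ENNReal.ofReal_sum_of_nonneg fun q _ =>
    mul_nonneg (mul_nonneg (le_max_right _ _) (hK0 q)) hs]
  refine Finset.sum_le_sum fun q _ => ?_
  rw [Set.preimage_ofPred_eq, hγ, setLIntegral_withDensity_eq_setLIntegral_mul _ (by fun_prop)
    (continuous_gaussWeight.measurable.ennreal_ofReal) (hmeas q)]
  calc _ ≤ ∫⁻ w in {w | |inner ℝ (p q.1.1 - p q.1.2) (π w) - (c q.1.2 - c q.1.1)| ≤ s},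
        ENNReal.ofReal (max C 0) * ENNReal.ofReal (gaussWeight w) := by
        refine lintegral_mono fun w => ?_
        simp only [Pi.mul_apply]
        gcongr
        exact (hC w).trans (le_max_left _ _)
    _ = ENNReal.ofReal (max C 0) * ∫⁻ w in
        {w | |inner ℝ (p q.1.1 - p q.1.2) (π w) - (c q.1.2 - c q.1.1)| ≤ s},
        ENNReal.ofReal (gaussWeight w) :=
        lintegral_const_mul _ continuous_gaussWeight.measurable.ennreal_ofReal
    _ ≤ ENNReal.ofReal (max C 0) * ENNReal.ofReal (K q * s) := by
        gcongr; exact hK q _ s hs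
    _ = _ := by rw [← ENNReal.ofReal_mul (le_max_right _ _), mul_assoc]

end TieSlab

/-! ### Perturbation of max-affine functions -/

section MaxAffine

variable {d k : ℕ} (p : Fin k → EuclideanSpace ℝ (Fin d)) (c : Fin k → ℝ)
  (u : EuclideanSpace ℝ (Fin d))

theorem le_maxAffine (i : Fin k) : inner ℝ u (p i) + c i ≤ maxAffine p c u :=
  le_ciSup (f := fun i => inner ℝ u (p i) + c i) (Set.finite_range _).bddAbove i

theorem maxAffine_le [Nonempty (Fin k)] {r : ℝ} (h : ∀ i, inner ℝ u (p i) + c i ≤ r) :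
    maxAffine p c u ≤ r := ciSup_le h

theorem exists_mem_laguerreCell [Nonempty (Fin k)] : ∃ i, u ∈ laguerreCell p c i := by
  obtain ⟨i, hi⟩ := exists_eq_ciSup_of_finite (f := fun i => inner ℝ u (p i) + c i)
  exact ⟨i, hi.symm⟩

theorem continuous_maxAffine [Nonempty (Fin k)] {X : Type*} [TopologicalSpace X]
    {f : X → Fin k → ℝ} {g : X → EuclideanSpace ℝ (Fin d)} (hf : Continuous f)
    (hg : Continuous g) : Continuous fun q => maxAffine p (f q) (g q) := by
  have h : (fun q => maxAffine p (f q) (g q)) =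
      fun q => Finset.univ.sup' Finset.univ_nonempty fun i => inner ℝ (g q) (p i) + f q i := by
    ext q; rw [Finset.sup'_univ_eq_ciSup]; rfl
  rw [h]
  exact Continuous.finset_sup'_apply _ fun i _ => by fun_prop

variable {p c u}

theorem maxAffine_add_le [Nonempty (Fin k)] {h : Fin k → ℝ} {δ : ℝ} (hh : ∀ i, h i ≤ δ) :
    maxAffine p (c + h) u ≤ maxAffine p c u + δ :=
  maxAffine_le _ _ _ fun i => by
    have := le_maxAffine p c u i
    simp only [Pi.add_apply]
    linarith [hh i]

theorem maxAffine_add_ge {i : Fin k} (hi : u ∈ laguerreCell p c i) (h : Fin k → ℝ) :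
    maxAffine p c u + h i ≤ maxAffine p (c + h) u := by
  have h1 : maxAffine p c u = inner ℝ u (p i) + c i := hi
  have h2 := le_maxAffine p (c + h) u i
  simp only [Pi.add_apply] at h2
  linarith

theorem abs_maxAffine_add_sub_le [Nonempty (Fin k)] {h : Fin k → ℝ} {δ : ℝ}
    (hh : ∀ i, |h i| ≤ δ) : |maxAffine p (c + h) u - maxAffine p c u| ≤ δ := by
  obtain ⟨i, hi⟩ := exists_mem_laguerreCell p c u
  have h1 := maxAffine_add_ge hi h
  have h2 := maxAffine_add_le (p := p) (c := c) (u := u) (fun i => (abs_le.1 (hh i)).2)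
  rw [abs_le]
  constructor <;> linarith [(abs_le.1 (hh i)).1]

theorem gap_of_notMem_tieSlab {s : ℝ} {i j : Fin k} (hi : u ∈ laguerreCell p c i)
    (hij : i ≠ j) (hu : u ∉ tieSlab p c s) :
    inner ℝ u (p j) + c j + s < inner ℝ u (p i) + c i := by
  have h1 : maxAffine p c u = inner ℝ u (p i) + c i := hi
  have h2 := le_maxAffine p c u j
  have h3 : s < |inner ℝ (p i - p j) u - (c j - c i)| := by
    by_contra! h
    exact hu ⟨i, j, hij, h⟩
  rw [inner_sub_left, real_inner_comm u (p i), real_inner_comm u (p j),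
    abs_of_nonneg (by linarith)] at h3
  linarith

/-- Two increments differ by at most `2 * δ`, so an index leading by more than that stays the
maximizer. -/
theorem maxAffine_add_eq [Nonempty (Fin k)] {h : Fin k → ℝ} {δ : ℝ} (hh : ∀ i, |h i| ≤ δ)
    {i : Fin k} (hi : u ∈ laguerreCell p c i) (hu : u ∉ tieSlab p c (2 * δ)) :
    maxAffine p (c + h) u = maxAffine p c u + h i := by
  refine le_antisymm (maxAffine_le _ _ _ fun j => ?_) (maxAffine_add_ge hi h)
  have h1 : maxAffine p c u = inner ℝ u (p i) + c i := hi
  rw [h1, Pi.add_apply]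
  by_cases hij : i = j
  · rw [hij]; linarith
  · have := gap_of_notMem_tieSlab hi hij hu
    linarith [(abs_le.1 (hh i)).1, (abs_le.1 (hh j)).2]

variable (p c) in
/-- The sum of the increments `h i` over the cells that contain `u`. -/
def cellSum (h : Fin k → ℝ) (u : EuclideanSpace ℝ (Fin d)) : ℝ :=
  ∑ i, (laguerreCell p c i).indicator (fun _ => h i) u

theorem abs_cellSum_le {h : Fin k → ℝ} {δ : ℝ} (hh : ∀ i, |h i| ≤ δ) :
    |cellSum p c h u| ≤ k * δ := by
  refine (Finset.abs_sum_le_sum_abs _ _).trans ?_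
  calc _ ≤ ∑ _i : Fin k, δ := by
        refine Finset.sum_le_sum fun i _ => ?_
        by_cases hu : u ∈ laguerreCell p c i
        · simpa [hu] using hh i
        · simpa [hu] using (abs_nonneg _).trans (hh i)
    _ = k * δ := by simp

theorem cellSum_eq {s : ℝ} (hs : 0 ≤ s) {i : Fin k} (hi : u ∈ laguerreCell p c i)
    (hu : u ∉ tieSlab p c s) (h : Fin k → ℝ) : cellSum p c h u = h i := by
  rw [cellSum, Finset.sum_eq_single i]
  · simp [hi]
  · intro j _ hj
    refine Set.indicator_of_notMem (fun hj' => ?_) _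
    have h1 : maxAffine p c u = inner ℝ u (p i) + c i := hi
    have h2 : maxAffine p c u = inner ℝ u (p j) + c j := hj'
    have := gap_of_notMem_tieSlab hi hj.symm hu
    linarith
  · simp

theorem cellSum_eq_maxAffine_sub [Nonempty (Fin k)] {h : Fin k → ℝ} {δ : ℝ}
    (hh : ∀ i, |h i| ≤ δ) (hδ : 0 ≤ δ) (hu : u ∉ tieSlab p c (2 * δ)) :
    cellSum p c h u = maxAffine p (c + h) u - maxAffine p c u := by
  obtain ⟨i, hi⟩ := exists_mem_laguerreCell p c u
  rw [cellSum_eq (by positivity) hi hu, maxAffine_add_eq hh hi hu]; ring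

theorem cellSum_le_maxAffine_sub [Nonempty (Fin k)] (h : Fin k → ℝ)
    (hu : u ∉ tieSlab p c 0) :
    cellSum p c h u ≤ maxAffine p (c + h) u - maxAffine p c u := by
  obtain ⟨i, hi⟩ := exists_mem_laguerreCell p c u
  rw [cellSum_eq le_rfl hi hu]
  linarith [maxAffine_add_ge hi h]

theorem measurableSet_laguerreCell [Nonempty (Fin k)] (i : Fin k) :
    MeasurableSet (laguerreCell p c i) := by
  refine (isClosed_eq ?_ (by fun_prop)).measurableSet
  exact continuous_maxAffine p continuous_const continuous_id

/-- Linear growth is absorbed by half of the quadratic term: `‖u‖ * P ≤ P ^ 2 + 1 / 4 * ‖u‖ ^ 2`. -/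
theorem maxAffine_le_norm [Nonempty (Fin k)] {P r : ℝ} (hP : ∀ i, ‖p i‖ ≤ P)
    (hc : ∀ i, c i ≤ r) : maxAffine p c u - 1 / 2 * ‖u‖ ^ 2 ≤ P ^ 2 + r - 1 / 4 * ‖u‖ ^ 2 := by
  have : maxAffine p c u ≤ ‖u‖ * P + r := maxAffine_le _ _ _ fun i =>
    add_le_add ((real_inner_le_norm _ _).trans (by gcongr; exact hP i)) (hc i)
  nlinarith [sq_nonneg (P - 1 / 2 * ‖u‖)]

end MaxAffine

/-! ### Pointwise linearization of the weight -/

section Weight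

variable {d n m : ℕ} {x : Fin n → EuclideanSpace ℝ (Fin d)} {y : Fin m → EuclideanSpace ℝ (Fin d)}

theorem abs_fstPart_le (z : Dual n m) (i : Fin n) : |fstPart z i| ≤ ‖z‖ :=
  PiLp.norm_apply_le z (Sum.inl i)

theorem abs_sndPart_le (z : Dual n m) (j : Fin m) : |sndPart z j| ≤ ‖z‖ :=
  PiLp.norm_apply_le z (Sum.inr j)

theorem continuous_fstPart : Continuous (fstPart (n := n) (m := m)) :=
  continuous_pi fun i => (EuclideanSpace.proj (𝕜 := ℝ) (Sum.inl i : Fin n ⊕ Fin m)).continuous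

theorem continuous_sndPart : Continuous (sndPart (n := n) (m := m)) :=
  continuous_pi fun j => (EuclideanSpace.proj (𝕜 := ℝ) (Sum.inr j : Fin n ⊕ Fin m)).continuous

theorem fstPart_add (z h : Dual n m) : fstPart (z + h) = fstPart z + fstPart h := rfl

theorem sndPart_add (z h : Dual n m) : sndPart (z + h) = sndPart z + sndPart h := rfl

theorem weight_pos (z : Dual n m) (w : EuclideanSpace ℝ (Fin d) × EuclideanSpace ℝ (Fin d)) :
    0 < weight x y z w := Real.exp_pos _

variable (x y) in
/-- The linearization at `z` of the logarithm of the weight, with increment `h`. -/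
def logWeightDiff (z h : Dual n m) (w : EuclideanSpace ℝ (Fin d) × EuclideanSpace ℝ (Fin d)) : ℝ :=
  cellSum x (fstPart z) (fstPart h) w.1 + cellSum y (sndPart z) (sndPart h) w.2

variable (x y) in
/-- The points `(x, y)` one of whose components is close to a tie of the affine functions. -/
def tieSet (z : Dual n m) (s : ℝ) : Set (EuclideanSpace ℝ (Fin d) × EuclideanSpace ℝ (Fin d)) :=
  Prod.fst ⁻¹' tieSlab x (fstPart z) s ∪ Prod.snd ⁻¹' tieSlab y (sndPart z) s

theorem measurableSet_tieSet (z : Dual n m) (s : ℝ) : MeasurableSet (tieSet x y z s) :=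
  (measurable_fst (measurableSet_tieSlab _ _ _)).union
    (measurable_snd (measurableSet_tieSlab _ _ _))

theorem weight_add (z h : Dual n m) (w : EuclideanSpace ℝ (Fin d) × EuclideanSpace ℝ (Fin d)) :
    weight x y (z + h) w = weight x y z w * Real.exp
      ((maxAffine x (fstPart z + fstPart h) w.1 - maxAffine x (fstPart z) w.1) +
      (maxAffine y (sndPart z + sndPart h) w.2 - maxAffine y (sndPart z) w.2)) := by
  rw [weight, weight, ← Real.exp_add, fstPart_add, sndPart_add]
  congr 1; ring

variable [Nonempty (Fin n)] [Nonempty (Fin m)]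

theorem continuous_weight (x : Fin n → EuclideanSpace ℝ (Fin d))
    (y : Fin m → EuclideanSpace ℝ (Fin d)) : Continuous fun q :
    Dual n m × (EuclideanSpace ℝ (Fin d) × EuclideanSpace ℝ (Fin d)) => weight x y q.1 q.2 := by
  have hα := (continuous_fstPart (n := n) (m := m)).comp
    (continuous_fst (Y := EuclideanSpace ℝ (Fin d) × EuclideanSpace ℝ (Fin d)))
  have hβ := (continuous_sndPart (n := n) (m := m)).comp
    (continuous_fst (Y := EuclideanSpace ℝ (Fin d) × EuclideanSpace ℝ (Fin d)))
  have hu := (continuous_fst (X := EuclideanSpace ℝ (Fin d)) (Y := EuclideanSpace ℝ (Fin d))).comp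
    (continuous_snd (X := Dual n m))
  have hv := (continuous_snd (X := EuclideanSpace ℝ (Fin d)) (Y := EuclideanSpace ℝ (Fin d))).comp
    (continuous_snd (X := Dual n m))
  exact Real.continuous_exp.comp ((((continuous_maxAffine x hα hu).add
    (continuous_maxAffine y hβ hv)).sub (continuous_const.mul (hu.norm.pow 2))).sub
      (continuous_const.mul (hv.norm.pow 2)))

theorem continuous_weight_right (z : Dual n m) : Continuous (weight x y z) :=
  (continuous_weight x y).comp (f := fun w => (z, w)) (by fun_prop)

variable (x y) in
theorem exists_weight_le_gaussWeight (R : ℝ) : ∃ M : ℝ, 0 ≤ M ∧ ∀ z : Dual n m, ‖z‖ ≤ R →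
    ∀ w, weight x y z w ≤ M * gaussWeight w := by
  obtain ⟨P, hP⟩ := (Set.finite_range fun i => ‖x i‖).bddAbove
  obtain ⟨Q, hQ⟩ := (Set.finite_range fun j => ‖y j‖).bddAbove
  refine ⟨Real.exp (P ^ 2 + R + (Q ^ 2 + R)), by positivity, fun z hz w => ?_⟩
  rw [weight, gaussWeight, ← Real.exp_add, Real.exp_le_exp]
  have h1 := maxAffine_le_norm (p := x) (c := fstPart z) (u := w.1) (r := R)
    (fun i => hP ⟨i, rfl⟩) fun i => (le_abs_self _).trans ((abs_fstPart_le z i).trans hz)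
  have h2 := maxAffine_le_norm (p := y) (c := sndPart z) (u := w.2) (r := R)
    (fun i => hQ ⟨i, rfl⟩) fun i => (le_abs_self _).trans ((abs_sndPart_le z i).trans hz)
  linarith

/-- Two errors add up: the Taylor remainder of `exp`, for which `‖h‖ ≤ 1 / 2` ensures an exponent of
size at most `1`, and the error of linearizing the maxima, which vanishes off the tie set of width
`2 * ‖h‖`. The latter is only first order in `‖h‖`, but so is the mass of its support. -/
theorem abs_weight_add_sub_le (z h : Dual n m) (hh : ‖h‖ ≤ 1 / 2)
    (w : EuclideanSpace ℝ (Fin d) × EuclideanSpace ℝ (Fin d)) :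
    |weight x y (z + h) w - weight x y z w - weight x y z w * logWeightDiff x y z h w| ≤
      weight x y z w * (4 * ‖h‖ ^ 2 + (n + m + 2) * ‖h‖ *
        (tieSet x y z (2 * ‖h‖)).indicator 1 w) := by
  set Δx := maxAffine x (fstPart z + fstPart h) w.1 - maxAffine x (fstPart z) w.1 with hΔx
  set Δy := maxAffine y (sndPart z + sndPart h) w.2 - maxAffine y (sndPart z) w.2 with hΔy
  have hx : |Δx| ≤ ‖h‖ := abs_maxAffine_add_sub_le (abs_fstPart_le h)
  have hy : |Δy| ≤ ‖h‖ := abs_maxAffine_add_sub_le (abs_sndPart_le h)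
  have hΔ : |Δx + Δy| ≤ 2 * ‖h‖ := (abs_add_le _ _).trans (by linarith)
  have hexp : |Real.exp (Δx + Δy) - 1 - (Δx + Δy)| ≤ 4 * ‖h‖ ^ 2 := by
    refine (Real.abs_exp_sub_one_sub_id_le (hΔ.trans (by linarith))).trans ?_
    rw [← sq_abs]
    calc _ ≤ (2 * ‖h‖) ^ 2 := by gcongr
      _ = _ := by ring
  have hlin : |Δx + Δy - logWeightDiff x y z h w| ≤
      (n + m + 2) * ‖h‖ * (tieSet x y z (2 * ‖h‖)).indicator 1 w := by
    by_cases hw : w ∈ tieSet x y z (2 * ‖h‖)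
    · have h1 := abs_cellSum_le (p := x) (c := fstPart z) (u := w.1) (abs_fstPart_le h)
      have h2 := abs_cellSum_le (p := y) (c := sndPart z) (u := w.2) (abs_sndPart_le h)
      have h3 : |logWeightDiff x y z h w| ≤ n * ‖h‖ + m * ‖h‖ :=
        (abs_add_le _ _).trans (add_le_add h1 h2)
      simp only [hw, Set.indicator_of_mem, Pi.one_apply, mul_one]
      refine (abs_sub _ _).trans ?_
      linarith
    · have hw' : w.1 ∉ tieSlab x (fstPart z) (2 * ‖h‖) ∧ w.2 ∉ tieSlab y (sndPart z) (2 * ‖h‖) := by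
        simpa [tieSet] using hw
      rw [logWeightDiff, cellSum_eq_maxAffine_sub (abs_fstPart_le h) (norm_nonneg _) hw'.1,
        cellSum_eq_maxAffine_sub (abs_sndPart_le h) (norm_nonneg _) hw'.2]
      simp [hw, ← hΔx, ← hΔy]
  have : weight x y (z + h) w - weight x y z w - weight x y z w * logWeightDiff x y z h w =
      weight x y z w * ((Real.exp (Δx + Δy) - 1 - (Δx + Δy)) +
        (Δx + Δy - logWeightDiff x y z h w)) := by
    rw [weight_add]; ring
  rw [this, abs_mul, abs_of_pos (weight_pos z w)]
  exact mul_le_mul_of_nonneg_left ((abs_add_le _ _).trans (add_le_add hexp hlin))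
    (weight_pos z w).le

/-- Away from ties the weight lies above its linearization, strictly unless its value at the
new point is the old one. -/
theorem weight_add_sub_nonneg (z h : Dual n m)
    {w : EuclideanSpace ℝ (Fin d) × EuclideanSpace ℝ (Fin d)} (hw : w ∉ tieSet x y z 0) :
    0 ≤ weight x y (z + h) w - weight x y z w - weight x y z w * logWeightDiff x y z h w ∧
    (weight x y (z + h) w - weight x y z w - weight x y z w * logWeightDiff x y z h w = 0 →
      maxAffine x (fstPart (z + h)) w.1 + maxAffine y (sndPart (z + h)) w.2 =
        maxAffine x (fstPart z) w.1 + maxAffine y (sndPart z) w.2) := by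
  have hw' : w.1 ∉ tieSlab x (fstPart z) 0 ∧ w.2 ∉ tieSlab y (sndPart z) 0 := by
    simpa [tieSet] using hw
  have h1 := cellSum_le_maxAffine_sub (fstPart h) hw'.1
  have h2 := cellSum_le_maxAffine_sub (sndPart h) hw'.2
  rw [weight_add, fstPart_add, sndPart_add]
  set Δ := (maxAffine x (fstPart z + fstPart h) w.1 - maxAffine x (fstPart z) w.1) +
    (maxAffine y (sndPart z + sndPart h) w.2 - maxAffine y (sndPart z) w.2) with hΔ
  -- The error is the weight times the sum of the nonnegative terms `exp Δ - 1 - Δ` and `Δ -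
  -- logWeightDiff x y z h w`; if it vanishes, the first one forces `Δ = 0`.
  have h3 : logWeightDiff x y z h w ≤ Δ := add_le_add h1 h2
  have h4 : weight x y z w * Real.exp Δ - weight x y z w - weight x y z w * logWeightDiff x y z h w
    = weight x y z w * (Real.exp Δ - 1 - logWeightDiff x y z h w) := by ring
  have h5 := Real.add_one_le_exp Δ
  rw [h4]
  refine ⟨mul_nonneg (weight_pos z w).le (by linarith), fun h0 => ?_⟩
  have h6 := (mul_eq_zero.1 h0).resolve_left (weight_pos z w).ne'
  have h7 : Δ = 0 := by
    by_contra hne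
    linarith [Real.add_one_lt_exp hne]
  linarith

end Weight

/-! ### Integrated linearization and the gradient of the dual objective -/

section Integration

variable {d n m : ℕ} {x : Fin n → EuclideanSpace ℝ (Fin d)} {y : Fin m → EuclideanSpace ℝ (Fin d)}
  {γ : Measure (EuclideanSpace ℝ (Fin d) × EuclideanSpace ℝ (Fin d))}

theorem exists_setLIntegral_tieSet_le
    {ρ : EuclideanSpace ℝ (Fin d) × EuclideanSpace ℝ (Fin d) → ℝ} (hρ : Measurable ρ)
    (hρ_bdd : ∃ C, ∀ w, ρ w ≤ C)
    (hγ : γ = volume.withDensity (fun w => ENNReal.ofReal (ρ w)))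
    (hx : Function.Injective x) (hy : Function.Injective y) :
    ∃ K : ℝ, 0 ≤ K ∧ ∀ (z : Dual n m) (s : ℝ), 0 ≤ s →
      ∫⁻ w in tieSet x y z s, ENNReal.ofReal (gaussWeight w) ∂γ ≤ ENNReal.ofReal (K * s) := by
  obtain ⟨K₁, h₁, hK₁⟩ := exists_setLIntegral_tieSlab_le hρ hρ_bdd hγ
    (ContinuousLinearMap.fst ℝ _ _) Prod.fst_surjective hx
  obtain ⟨K₂, h₂, hK₂⟩ := exists_setLIntegral_tieSlab_le hρ hρ_bdd hγ
    (ContinuousLinearMap.snd ℝ _ _) Prod.snd_surjective hy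
  refine ⟨K₁ + K₂, add_nonneg h₁ h₂, fun z s hs => ?_⟩
  rw [add_mul, ENNReal.ofReal_add (by positivity) (by positivity)]
  exact (lintegral_union_le _ _ _).trans (add_le_add (hK₁ _ s hs) (hK₂ _ s hs))

theorem measure_tieSet_zero {K : ℝ}
    (hK : ∀ (z : Dual n m) (s : ℝ), 0 ≤ s →
      ∫⁻ w in tieSet x y z s, ENNReal.ofReal (gaussWeight w) ∂γ ≤ ENNReal.ofReal (K * s))
    (z : Dual n m) : ∀ᵐ w ∂γ, w ∉ tieSet x y z 0 := by
  have h := hK z 0 le_rfl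
  rw [mul_zero, ENNReal.ofReal_zero, nonpos_iff_eq_zero,
    lintegral_eq_zero_iff continuous_gaussWeight.measurable.ennreal_ofReal,
    EventuallyEq, ae_restrict_iff' (measurableSet_tieSet z 0)] at h
  filter_upwards [h] with w hw hmem
  have := hw hmem
  rw [Pi.zero_apply, ENNReal.ofReal_eq_zero] at this
  exact absurd this (gaussWeight_pos w).not_ge

theorem setIntegral_tieSet_le [IsFiniteMeasure γ] {K : ℝ} (hK0 : 0 ≤ K)
    (hK : ∀ (z : Dual n m) (s : ℝ), 0 ≤ s →
      ∫⁻ w in tieSet x y z s, ENNReal.ofReal (gaussWeight w) ∂γ ≤ ENNReal.ofReal (K * s))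
    (z : Dual n m) {s : ℝ} (hs : 0 ≤ s) : ∫ w in tieSet x y z s, gaussWeight w ∂γ ≤ K * s := by
  rw [integral_eq_lintegral_of_nonneg_ae (Eventually.of_forall fun w => (gaussWeight_pos w).le)
    continuous_gaussWeight.aestronglyMeasurable]
  exact ENNReal.toReal_le_of_le_ofReal (by positivity) (hK z s hs)

theorem integrable_gaussWeight [IsFiniteMeasure γ] : Integrable gaussWeight γ :=
  Integrable.of_bound continuous_gaussWeight.aestronglyMeasurable 1
    (Eventually.of_forall fun w => by
      rw [Real.norm_of_nonneg (gaussWeight_pos w).le]; exact gaussWeight_le_one w)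

variable [Nonempty (Fin n)] [Nonempty (Fin m)] [IsProbabilityMeasure γ]

theorem integrable_weight (z : Dual n m) : Integrable (weight x y z) γ := by
  obtain ⟨M, -, hM⟩ := exists_weight_le_gaussWeight x y ‖z‖
  refine (integrable_gaussWeight.const_mul M).mono'
    (continuous_weight_right z).aestronglyMeasurable (Eventually.of_forall fun w => ?_)
  rw [Real.norm_of_nonneg (weight_pos z w).le]
  exact hM z le_rfl w

theorem measurableSet_fst_cell (c : Fin n → ℝ) (i : Fin n) :
    MeasurableSet (laguerreCell x c i ×ˢ (Set.univ : Set (EuclideanSpace ℝ (Fin d)))) :=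
  (measurableSet_laguerreCell i).prod MeasurableSet.univ

theorem measurableSet_snd_cell (c : Fin m → ℝ) (j : Fin m) :
    MeasurableSet ((Set.univ : Set (EuclideanSpace ℝ (Fin d))) ×ˢ laguerreCell y c j) :=
  MeasurableSet.univ.prod (measurableSet_laguerreCell j)

omit [Nonempty (Fin n)] [Nonempty (Fin m)] in
theorem weight_mul_logWeightDiff (z h : Dual n m)
    (w : EuclideanSpace ℝ (Fin d) × EuclideanSpace ℝ (Fin d)) :
    weight x y z w * logWeightDiff x y z h w =
      ∑ i, fstPart h i * (laguerreCell x (fstPart z) i ×ˢ Set.univ).indicator (weight x y z) w +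
      ∑ j, sndPart h j *
        (Set.univ ×ˢ laguerreCell y (sndPart z) j).indicator (weight x y z) w := by
  rw [logWeightDiff, cellSum, cellSum, mul_add, Finset.mul_sum, Finset.mul_sum]
  congr 1 <;> refine Finset.sum_congr rfl fun i _ => ?_
  · by_cases hw : w.1 ∈ laguerreCell x (fstPart z) i
    · rw [Set.indicator_of_mem hw, Set.indicator_of_mem (by simpa [Set.mem_prod] using hw)]; ring
    · rw [Set.indicator_of_notMem hw, Set.indicator_of_notMem (by simpa [Set.mem_prod] using hw)]
      ring
  · by_cases hw : w.2 ∈ laguerreCell y (sndPart z) i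
    · rw [Set.indicator_of_mem hw, Set.indicator_of_mem (by simpa [Set.mem_prod] using hw)]; ring
    · rw [Set.indicator_of_notMem hw, Set.indicator_of_notMem (by simpa [Set.mem_prod] using hw)]
      ring

theorem integrable_fst_indicator (z : Dual n m) (i : Fin n) (r : ℝ) : Integrable
    (fun w => r * (laguerreCell x (fstPart z) i ×ˢ Set.univ).indicator (weight x y z) w) γ :=
  ((integrable_weight z).indicator (measurableSet_fst_cell _ i)).const_mul r

theorem integrable_snd_indicator (z : Dual n m) (j : Fin m) (r : ℝ) : Integrable
    (fun w => r * (Set.univ ×ˢ laguerreCell y (sndPart z) j).indicator (weight x y z) w) γ :=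
  ((integrable_weight z).indicator (measurableSet_snd_cell _ j)).const_mul r

theorem integrable_weight_mul_logWeightDiff (z h : Dual n m) :
    Integrable (fun w => weight x y z w * logWeightDiff x y z h w) γ := by
  simp_rw [weight_mul_logWeightDiff]
  exact (integrable_finsetSum _ fun i _ => integrable_fst_indicator z i _).add
    (integrable_finsetSum _ fun j _ => integrable_snd_indicator z j _)

theorem integral_weight_mul_logWeightDiff (z h : Dual n m) :
    ∫ w, weight x y z w * logWeightDiff x y z h w ∂γ =
      ∑ i, fstPart h i * ∫ w in laguerreCell x (fstPart z) i ×ˢ Set.univ, weight x y z w ∂γ +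
      ∑ j, sndPart h j * ∫ w in Set.univ ×ˢ laguerreCell y (sndPart z) j, weight x y z w ∂γ := by
  simp_rw [weight_mul_logWeightDiff]
  rw [integral_add (integrable_finsetSum _ fun i _ => integrable_fst_indicator z i _)
    (integrable_finsetSum _ fun j _ => integrable_snd_indicator z j _),
    integral_finsetSum _ fun i _ => integrable_fst_indicator z i _,
    integral_finsetSum _ fun j _ => integrable_snd_indicator z j _]
  congr 1 <;> refine Finset.sum_congr rfl fun i _ => ?_
  · rw [integral_const_mul, integral_indicator (measurableSet_fst_cell _ i)]
  · rw [integral_const_mul, integral_indicator (measurableSet_snd_cell _ i)]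

variable (x y) in
/-- The error of the linearization of the weight. -/
def weightError (z h : Dual n m) (w : EuclideanSpace ℝ (Fin d) × EuclideanSpace ℝ (Fin d)) : ℝ :=
  weight x y (z + h) w - weight x y z w - weight x y z w * logWeightDiff x y z h w

theorem integrable_weightError (z h : Dual n m) : Integrable (weightError x y z h) γ :=
  ((integrable_weight _).sub (integrable_weight _)).sub (integrable_weight_mul_logWeightDiff z h)

theorem inner_dualGradient (a : Fin n → ℝ) (b : Fin m → ℝ) (z h : Dual n m) :
    inner ℝ (dualGradient a x b y γ z) h = ∑ i, a i * fstPart h i + ∑ j, b j * sndPart h j -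
      ∫ w, weight x y z w * logWeightDiff x y z h w ∂γ := by
  rw [integral_weight_mul_logWeightDiff, PiLp.inner_apply, Fintype.sum_sum_type]
  simp only [dualGradient, Sum.elim_inl, Sum.elim_inr, RCLike.inner_apply, conj_trivial,
    mul_sub, Finset.sum_sub_distrib]
  simp only [fstPart, sndPart, mul_comm (a _), mul_comm (b _)]
  ring

/-- Only the integral is nonlinear in `z`, so this expansion is exact: concavity, differentiability
and smoothness all reduce to the sign and size of the integrated `weightError`. -/
theorem dualObjective_add (a : Fin n → ℝ) (b : Fin m → ℝ) (z h : Dual n m) :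
    dualObjective a x b y γ (z + h) = dualObjective a x b y γ z +
      inner ℝ (dualGradient a x b y γ z) h - ∫ w, weightError x y z h w ∂γ := by
  have h1 : ∫ w, weightError x y z h w ∂γ = ∫ w, weight x y (z + h) w ∂γ -
      ∫ w, weight x y z w ∂γ - ∫ w, weight x y z w * logWeightDiff x y z h w ∂γ := by
    have h2 : Integrable (fun w => weight x y (z + h) w - weight x y z w) γ :=
      (integrable_weight _).sub (integrable_weight _)
    unfold weightError
    rw [integral_sub h2
      (integrable_weight_mul_logWeightDiff z h),
      integral_sub (integrable_weight _) (integrable_weight _)]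
  rw [h1, inner_dualGradient, dualObjective, dualObjective, fstPart_add, sndPart_add]
  simp only [Pi.add_apply, mul_add, Finset.sum_add_distrib]
  ring

omit [IsProbabilityMeasure γ] in
theorem weightError_nonneg {K : ℝ}
    (hK : ∀ (z : Dual n m) (s : ℝ), 0 ≤ s →
      ∫⁻ w in tieSet x y z s, ENNReal.ofReal (gaussWeight w) ∂γ ≤ ENNReal.ofReal (K * s))
    (z h : Dual n m) : 0 ≤ᵐ[γ] weightError x y z h := by
  filter_upwards [measure_tieSet_zero hK z] with w hw using (weight_add_sub_nonneg z h hw).1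

theorem exists_abs_integral_weightError_le {K : ℝ} (hK0 : 0 ≤ K)
    (hK : ∀ (z : Dual n m) (s : ℝ), 0 ≤ s →
      ∫⁻ w in tieSet x y z s, ENNReal.ofReal (gaussWeight w) ∂γ ≤ ENNReal.ofReal (K * s))
    (R : ℝ) : ∃ L : ℝ, ∀ z h : Dual n m, ‖z‖ ≤ R → ‖h‖ ≤ 1 / 2 →
      |∫ w, weightError x y z h w ∂γ| ≤ L * ‖h‖ ^ 2 := by
  obtain ⟨M, hM0, hM⟩ := exists_weight_le_gaussWeight x y (n := n) (m := m) R
  refine ⟨M * (4 + (n + m + 2) * (K * 2)), fun z h hz hh => ?_⟩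
  set T := tieSet x y z (2 * ‖h‖) with hT
  have hTm : MeasurableSet T := measurableSet_tieSet z _
  have hint : Integrable (fun w => M * (4 * ‖h‖ ^ 2 * gaussWeight w +
      (n + m + 2) * ‖h‖ * T.indicator gaussWeight w)) γ :=
    ((integrable_gaussWeight.const_mul _).add
      ((integrable_gaussWeight.indicator hTm).const_mul _)).const_mul M
  calc |∫ w, weightError x y z h w ∂γ| ≤ ∫ w, |weightError x y z h w| ∂γ :=
        abs_integral_le_integral_abs
    _ ≤ ∫ w, M * (4 * ‖h‖ ^ 2 * gaussWeight w +
        (n + m + 2) * ‖h‖ * T.indicator gaussWeight w) ∂γ := by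
        refine integral_mono (integrable_weightError z h).abs hint fun w => ?_
        refine (abs_weight_add_sub_le z h hh w).trans ?_
        have h1 : (0 : ℝ) ≤ T.indicator 1 w := Set.indicator_nonneg (fun _ _ => zero_le_one) w
        have h2 : gaussWeight w * T.indicator 1 w = T.indicator gaussWeight w := by
          by_cases hw : w ∈ T <;> simp [hw]
        calc _ ≤ M * gaussWeight w * (4 * ‖h‖ ^ 2 + (n + m + 2) * ‖h‖ * T.indicator 1 w) := by
              gcongr; exact hM z hz w
          _ = _ := by rw [← h2]; ring
    _ = M * (4 * ‖h‖ ^ 2 * ∫ w, gaussWeight w ∂γ +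
        (n + m + 2) * ‖h‖ * ∫ w in T, gaussWeight w ∂γ) := by
        rw [integral_const_mul, integral_add (integrable_gaussWeight.const_mul _)
          ((integrable_gaussWeight.indicator hTm).const_mul _), integral_const_mul,
          integral_const_mul, integral_indicator hTm]
    _ ≤ M * (4 * ‖h‖ ^ 2 * 1 + (n + m + 2) * ‖h‖ * (K * (2 * ‖h‖))) := by
        gcongr
        · calc ∫ w, gaussWeight w ∂γ ≤ ∫ _w, (1 : ℝ) ∂γ :=
              integral_mono integrable_gaussWeight (integrable_const _) gaussWeight_le_one
            _ = 1 := by simp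
        · exact setIntegral_tieSet_le hK0 hK z (by positivity)
    _ = _ := by ring

theorem hasGradientAt_dualObjective {K : ℝ} (hK0 : 0 ≤ K)
    (hK : ∀ (z : Dual n m) (s : ℝ), 0 ≤ s →
      ∫⁻ w in tieSet x y z s, ENNReal.ofReal (gaussWeight w) ∂γ ≤ ENNReal.ofReal (K * s))
    (a : Fin n → ℝ) (b : Fin m → ℝ) (z : Dual n m) :
    HasGradientAt (dualObjective a x b y γ) (dualGradient a x b y γ z) z := by
  obtain ⟨L, hL⟩ := exists_abs_integral_weightError_le hK0 hK ‖z‖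
  rw [hasGradientAt_iff_isLittleO_nhds_zero]
  refine Asymptotics.IsBigO.trans_isLittleO (g := fun h : Dual n m => ‖h‖ ^ 2) ?_
    (Asymptotics.isLittleO_norm_pow_id one_lt_two)
  refine Asymptotics.IsBigO.of_bound L ?_
  filter_upwards [Metric.closedBall_mem_nhds (0 : Dual n m) (by norm_num : (0 : ℝ) < 1 / 2)]
    with h hh
  have := hL z h le_rfl (by simpa using hh)
  rw [dualObjective_add, Real.norm_eq_abs, norm_pow, norm_norm]
  convert this using 1
  rw [← abs_neg]; congr 1; ring

end Integration

/-! ### Shift invariance and bounded superlevel sets -/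

section Coercivity

variable {d n m : ℕ} {x : Fin n → EuclideanSpace ℝ (Fin d)} {y : Fin m → EuclideanSpace ℝ (Fin d)}
  {γ : Measure (EuclideanSpace ℝ (Fin d) × EuclideanSpace ℝ (Fin d))}

variable (n m) in
/-- The direction `(1, -1)`, along which the dual objective is constant. -/
def shiftVector : Dual n m := WithLp.toLp 2 (Sum.elim (fun _ => 1) (fun _ => -1))

theorem inner_shiftVector (z : Dual n m) :
    inner ℝ (shiftVector n m) z = ∑ i, fstPart z i - ∑ j, sndPart z j := by
  rw [PiLp.inner_apply, Fintype.sum_sum_type]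
  simp [shiftVector, fstPart, sndPart, sub_eq_add_neg]

theorem norm_le_of_abs_le {z : Dual n m} {r : ℝ} (h₁ : ∀ i, |fstPart z i| ≤ r)
    (h₂ : ∀ j, |sndPart z j| ≤ r) : ‖z‖ ≤ √((n + m) * r ^ 2) := by
  rw [EuclideanSpace.norm_eq, Fintype.sum_sum_type]
  refine Real.sqrt_le_sqrt ?_
  have h3 : ∑ i, ‖z (Sum.inl i)‖ ^ 2 ≤ ∑ _i : Fin n, r ^ 2 :=
    Finset.sum_le_sum fun i _ => pow_le_pow_left₀ (norm_nonneg _) (h₁ i) 2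
  have h4 : ∑ j, ‖z (Sum.inr j)‖ ^ 2 ≤ ∑ _j : Fin m, r ^ 2 :=
    Finset.sum_le_sum fun j _ => pow_le_pow_left₀ (norm_nonneg _) (h₂ j) 2
  simp only [Finset.sum_const, Finset.card_univ, Fintype.card_fin, nsmul_eq_mul] at h3 h4
  linarith

variable [Nonempty (Fin n)] [Nonempty (Fin m)]

theorem logWeightDiff_shiftVector {z : Dual n m}
    {w : EuclideanSpace ℝ (Fin d) × EuclideanSpace ℝ (Fin d)} (hw : w ∉ tieSet x y z 0) :
    logWeightDiff x y z (shiftVector n m) w = 0 := by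
  have hw' : w.1 ∉ tieSlab x (fstPart z) 0 ∧ w.2 ∉ tieSlab y (sndPart z) 0 := by
    simpa [tieSet] using hw
  obtain ⟨i, hi⟩ := exists_mem_laguerreCell x (fstPart z) w.1
  obtain ⟨j, hj⟩ := exists_mem_laguerreCell y (sndPart z) w.2
  rw [logWeightDiff, cellSum_eq le_rfl hi hw'.1, cellSum_eq le_rfl hj hw'.2]
  simp [shiftVector, fstPart, sndPart]

/-- Up to null sets the cells of either family partition the space, so both families of integrals
have the same sum, and `a` and `b` have the same total. -/
theorem inner_shiftVector_dualGradient [IsProbabilityMeasure γ] {K : ℝ}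
    (hK : ∀ (z : Dual n m) (s : ℝ), 0 ≤ s →
      ∫⁻ w in tieSet x y z s, ENNReal.ofReal (gaussWeight w) ∂γ ≤ ENNReal.ofReal (K * s))
    {a : Fin n → ℝ} {b : Fin m → ℝ} (ha_sum : ∑ i, a i = 1) (hb_sum : ∑ j, b j = 1)
    (z : Dual n m) : inner ℝ (shiftVector n m) (dualGradient a x b y γ z) = 0 := by
  have h0 : ∫ w, weight x y z w * logWeightDiff x y z (shiftVector n m) w ∂γ = 0 := by
    refine integral_eq_zero_of_ae ?_
    filter_upwards [measure_tieSet_zero hK z] with w hw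
    rw [logWeightDiff_shiftVector hw, mul_zero, Pi.zero_apply]
  rw [real_inner_comm, inner_dualGradient, h0]
  simp [shiftVector, fstPart, sndPart, ha_sum, hb_sum]

-- Keeping one affine piece in each maximum bounds the weight below. The minimum over the finitely
-- many pairs of pieces makes `q` independent of `z`.
variable (x y γ) in
theorem exists_exp_le_integral_weight [IsProbabilityMeasure γ] : ∃ q : ℝ, 0 < q ∧
    ∀ (z : Dual n m) i j,
      q * Real.exp (fstPart z i + sndPart z j) ≤ ∫ w, weight x y z w ∂γ := by
  set φ : Fin n × Fin m → EuclideanSpace ℝ (Fin d) × EuclideanSpace ℝ (Fin d) → ℝ := fun ij w =>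
    inner ℝ w.1 (x ij.1) + inner ℝ w.2 (y ij.2) - 1 / 2 * ‖w.1‖ ^ 2 - 1 / 2 * ‖w.2‖ ^ 2 with hφ
  have hle : ∀ (z : Dual n m) (i : Fin n) (j : Fin m) w,
      Real.exp (φ (i, j) w) * Real.exp (fstPart z i + sndPart z j) ≤ weight x y z w := by
    intro z i j w
    rw [weight, ← Real.exp_add, Real.exp_le_exp]
    have h1 := le_maxAffine x (fstPart z) w.1 i
    have h2 := le_maxAffine y (sndPart z) w.2 j
    simp only [hφ]
    linarith
  have hint : ∀ ij, Integrable (fun w => Real.exp (φ ij w)) γ := by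
    intro ij
    refine (integrable_weight (x := x) (y := y) (0 : Dual n m)).mono' ?_
      (Eventually.of_forall fun w => ?_)
    · have : Continuous fun w => Real.exp (φ ij w) := by simp only [hφ]; fun_prop
      exact this.aestronglyMeasurable
    · rw [Real.norm_of_nonneg (Real.exp_pos _).le]
      simpa [fstPart, sndPart] using hle 0 ij.1 ij.2 w
  obtain ⟨ij₀, h₀⟩ := Finite.exists_min fun ij => ∫ w, Real.exp (φ ij w) ∂γ
  refine ⟨_, integral_exp_pos (hint ij₀), fun z i j => ?_⟩
  calc _ ≤ (∫ w, Real.exp (φ (i, j) w) ∂γ) * Real.exp (fstPart z i + sndPart z j) :=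
        mul_le_mul_of_nonneg_right (h₀ (i, j)) (Real.exp_pos _).le
    _ = ∫ w, Real.exp (φ (i, j) w) * Real.exp (fstPart z i + sndPart z j) ∂γ :=
        (integral_mul_const _ _).symm
    _ ≤ _ := integral_mono ((hint _).mul_const _) (integrable_weight z) (hle z i j)

/-- With `A` and `B` the largest entries of the two parts, `-U` controls `q * exp (A + B) - (A + B)`
plus the weighted gaps below `A` and `B`. This bounds `A + B` and, since the weights are positive,
every gap. The slice `inner ℝ (shiftVector n m) z = s` then controls `n * A - m * B`, which
separates `A` from `B`. -/
theorem isBounded_superlevel [IsProbabilityMeasure γ] {a : Fin n → ℝ} {b : Fin m → ℝ}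
    (ha_pos : ∀ i, 0 < a i) (ha_sum : ∑ i, a i = 1) (hb_pos : ∀ j, 0 < b j)
    (hb_sum : ∑ j, b j = 1) (s c : ℝ) : Bornology.IsBounded
      {z : Dual n m | inner ℝ (shiftVector n m) z = s ∧ -dualObjective a x b y γ z ≤ c} := by
  obtain ⟨q, hq, hqW⟩ := exists_exp_le_integral_weight x y γ
  set D₁ := c + (∑ i, a i * (1 / 2 * ‖x i‖ ^ 2) + ∑ j, b j * (1 / 2 * ‖y j‖ ^ 2) + 1) with hD₁
  -- Chosen so that `exp t ≥ t + 1` at `t = A + B + log (q / 2)` reads `2 * (A + B) + Λ ≤ q * exp (A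
  -- + B)`. Below, `D₂` bounds the weighted gaps, `D₃` each gap, `D₄` the sum `|A + B|`, and `D₅`
  -- bounds `|A|`.
  set Λ := 2 * (1 + Real.log (q / 2)) with hΛ
  set D₂ := D₁ - Λ / 2 with hD₂
  set D₃ := ∑ i, D₂ / a i + ∑ j, D₂ / b j with hD₃
  set D₄ := |D₁| + |Λ| with hD₄
  set D₅ := |s| + (n + m) * D₃ + m * D₄ with hD₅
  refine isBounded_iff_forall_norm_le.2 ⟨√((n + m) * (D₅ + D₄ + D₃) ^ 2), ?_⟩
  rintro z ⟨hzs, hzc⟩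
  rw [inner_shiftVector] at hzs
  obtain ⟨i₀, hi₀⟩ := Finite.exists_max (fstPart z)
  obtain ⟨j₀, hj₀⟩ := Finite.exists_max (sndPart z)
  set A := fstPart z i₀
  set B := sndPart z j₀
  have hexp : 2 * (A + B) + Λ ≤ q * Real.exp (A + B) := by
    have h1 := Real.add_one_le_exp (A + B + Real.log (q / 2))
    rw [Real.exp_add, Real.exp_log (by positivity)] at h1
    linarith
  have hexp0 : 0 < q * Real.exp (A + B) := by positivity
  have hW := hqW z i₀ j₀
  set Sa := ∑ i, a i * (A - fstPart z i) with hSa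
  set Sb := ∑ j, b j * (B - sndPart z j) with hSb
  have hSa_eq : Sa = A - ∑ i, a i * fstPart z i := by
    rw [hSa]; simp only [mul_sub, Finset.sum_sub_distrib]
    rw [← Finset.sum_mul, ha_sum, one_mul]
  have hSb_eq : Sb = B - ∑ j, b j * sndPart z j := by
    rw [hSb]; simp only [mul_sub, Finset.sum_sub_distrib]
    rw [← Finset.sum_mul, hb_sum, one_mul]
  have hSa_nonneg : ∀ i ∈ Finset.univ, 0 ≤ a i * (A - fstPart z i) := fun i _ =>
    mul_nonneg (ha_pos i).le (sub_nonneg.2 (hi₀ i))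
  have hSb_nonneg : ∀ j ∈ Finset.univ, 0 ≤ b j * (B - sndPart z j) := fun j _ =>
    mul_nonneg (hb_pos j).le (sub_nonneg.2 (hj₀ j))
  have hSa0 : 0 ≤ Sa := Finset.sum_nonneg hSa_nonneg
  have hSb0 : 0 ≤ Sb := Finset.sum_nonneg hSb_nonneg
  have hmain : q * Real.exp (A + B) - (A + B) + (Sa + Sb) ≤ D₁ := by
    simp only [dualObjective, mul_add, Finset.sum_add_distrib] at hzc
    rw [hSa_eq, hSb_eq, hD₁]
    linarith
  have hS : Sa + Sb ≤ D₂ := by rw [hD₂]; linarith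
  have hD₂0 : 0 ≤ D₂ := by linarith
  have hAB : |A + B| ≤ D₄ := by
    rw [abs_le, hD₄]
    constructor <;> linarith [le_abs_self D₁, neg_abs_le Λ, abs_nonneg Λ]
  have hα : ∀ i, A - fstPart z i ≤ D₃ := by
    intro i
    have h1 : a i * (A - fstPart z i) ≤ D₂ :=
      (Finset.single_le_sum hSa_nonneg (Finset.mem_univ i)).trans (by linarith)
    have h2 : A - fstPart z i ≤ D₂ / a i := by
      rw [le_div_iff₀ (ha_pos i)]; linarith
    have h3 := Finset.single_le_sum (f := fun i => D₂ / a i)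
      (fun i _ => div_nonneg hD₂0 (ha_pos i).le) (Finset.mem_univ i)
    have h4 : 0 ≤ ∑ j, D₂ / b j := Finset.sum_nonneg fun j _ => div_nonneg hD₂0 (hb_pos j).le
    linarith
  have hβ : ∀ j, B - sndPart z j ≤ D₃ := by
    intro j
    have h1 : b j * (B - sndPart z j) ≤ D₂ :=
      (Finset.single_le_sum hSb_nonneg (Finset.mem_univ j)).trans (by linarith)
    have h2 : B - sndPart z j ≤ D₂ / b j := by
      rw [le_div_iff₀ (hb_pos j)]; linarith
    have h3 := Finset.single_le_sum (f := fun j => D₂ / b j)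
      (fun j _ => div_nonneg hD₂0 (hb_pos j).le) (Finset.mem_univ j)
    have h4 : 0 ≤ ∑ i, D₂ / a i := Finset.sum_nonneg fun i _ => div_nonneg hD₂0 (ha_pos i).le
    linarith
  have hD₃0 : 0 ≤ D₃ := (sub_nonneg.2 (hi₀ i₀)).trans (hα i₀)
  have hsumα : n * A - n * D₃ ≤ ∑ i, fstPart z i ∧ ∑ i, fstPart z i ≤ n * A := by
    constructor
    · calc _ = ∑ _i : Fin n, (A - D₃) := by simp
        _ ≤ _ := Finset.sum_le_sum fun i _ => by linarith [hα i]
    · calc _ ≤ ∑ _i : Fin n, A := Finset.sum_le_sum fun i _ => hi₀ i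
        _ = _ := by simp
  have hsumβ : m * B - m * D₃ ≤ ∑ j, sndPart z j ∧ ∑ j, sndPart z j ≤ m * B := by
    constructor
    · calc _ = ∑ _j : Fin m, (B - D₃) := by simp
        _ ≤ _ := Finset.sum_le_sum fun j _ => by linarith [hβ j]
    · calc _ ≤ ∑ _j : Fin m, B := Finset.sum_le_sum fun j _ => hj₀ j
        _ = _ := by simp
  have hn1 : (1 : ℝ) ≤ n := by
    have := Fin.pos_iff_nonempty.2 ‹Nonempty (Fin n)›
    exact_mod_cast this
  have hm0 : (0 : ℝ) ≤ m := Nat.cast_nonneg m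
  have hA : |A| ≤ D₅ := by
    have h1 : |(n + m) * A| ≤ D₅ := by
      have h2 : (n + m) * A = (n * A - m * B) + m * (A + B) := by ring
      have h3 : |m * (A + B)| ≤ m * D₄ := by
        rw [abs_mul, abs_of_nonneg hm0]; gcongr
      have h4 : |n * A - m * B| ≤ |s| + (n + m) * D₃ := by
        have h5 : 0 ≤ n * D₃ := by positivity
        have h6 : 0 ≤ m * D₃ := by positivity
        rw [abs_le]
        constructor <;> linarith [le_abs_self s, neg_abs_le s, hsumα.1, hsumα.2, hsumβ.1, hsumβ.2]
      rw [h2]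
      exact (abs_add_le _ _).trans (by linarith)
    rw [abs_mul, abs_of_nonneg (by positivity)] at h1
    nlinarith [abs_nonneg A]
  have hB : |B| ≤ D₅ + D₄ := by
    have : B = (A + B) - A := by ring
    rw [this]
    exact (abs_sub _ _).trans (by linarith)
  have hD₄0 : 0 ≤ D₄ := (abs_nonneg _).trans hAB
  have hD₅0 : 0 ≤ D₅ := (abs_nonneg _).trans hA
  refine norm_le_of_abs_le (fun i => ?_) fun j => ?_
  · rw [abs_le]
    constructor <;> linarith [hα i, hi₀ i, (abs_le.1 hA).1, (abs_le.1 hA).2]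
  · rw [abs_le]
    constructor <;> linarith [hβ j, hj₀ j, (abs_le.1 hB).1, (abs_le.1 hB).2]

end Coercivity

/-! ### Uniqueness up to shift -/

section Uniqueness

variable {d n m : ℕ} {x : Fin n → EuclideanSpace ℝ (Fin d)} {y : Fin m → EuclideanSpace ℝ (Fin d)}
  {γ : Measure (EuclideanSpace ℝ (Fin d) × EuclideanSpace ℝ (Fin d))}

/-- On a connected open set, a function of the first component that equals a function of the second
component is constant. -/
theorem exists_eq_const_of_fst_eq_snd {X Y : Type*} [TopologicalSpace X] [TopologicalSpace Y]
    {O : Set (X × Y)} (hO : IsOpen O) (hconn : IsConnected O) {φ : X → ℝ} {ψ : Y → ℝ}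
    (h : ∀ w ∈ O, φ w.1 = ψ w.2) : ∃ r, ∀ w ∈ O, φ w.1 = r := by
  obtain ⟨w₀, hw₀⟩ := hconn.nonempty
  refine ⟨φ w₀.1, fun w hw => ?_⟩
  refine hconn.isPreconnected.induction₂ (fun w w' => φ w.1 = φ w'.1) (fun w hw => ?_)
    (fun _ _ _ _ _ _ h1 h2 => h1.trans h2) (fun _ _ _ _ h1 => h1.symm) hw hw₀
  -- In a product neighbourhood inside `O`, the mixed point `(w'.1, w.2)` links the two values: `φ
  -- w'.1 = ψ w.2 = φ w.1`.
  obtain ⟨U, hU, V, hV, hUV⟩ := mem_nhds_prod_iff.1 (hO.mem_nhds hw)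
  refine mem_nhdsWithin_of_mem_nhds ?_
  filter_upwards [prod_mem_nhds hU hV] with w' hw'
  have h1 := h (w'.1, w.2) (hUV ⟨hw'.1, mem_of_mem_nhds hV⟩)
  exact (h w hw).trans h1.symm

theorem dualGradient_eq_zero_of_isMaxOn {a : Fin n → ℝ} {b : Fin m → ℝ} {z : Dual n m}
    (hgrad : HasGradientAt (dualObjective a x b y γ) (dualGradient a x b y γ z) z)
    (hz : IsMaxOn (dualObjective a x b y γ) Set.univ z) : dualGradient a x b y γ z = 0 := by
  have h := (hz.isLocalMax univ_mem).hasFDerivAt_eq_zero hgrad.hasFDerivAt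
  simpa using h

theorem ae_mem_of_withDensity
    {ρ : EuclideanSpace ℝ (Fin d) × EuclideanSpace ℝ (Fin d) → ℝ} (hρ : Measurable ρ)
    (hγ : γ = volume.withDensity (fun w => ENNReal.ofReal (ρ w))) : ∀ᵐ w ∂γ, 0 < ρ w := by
  rw [hγ, ae_withDensity_iff hρ.ennreal_ofReal]
  refine Eventually.of_forall fun w hw => ?_
  by_contra! h
  exact hw (ENNReal.ofReal_of_nonpos h)

/-- The set of disagreement inside `{ρ > 0}` is open and Lebesgue null, hence empty. -/
theorem eqOn_of_ae_eq_withDensity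
    {ρ : EuclideanSpace ℝ (Fin d) × EuclideanSpace ℝ (Fin d) → ℝ} (hρ : Continuous ρ)
    (hγ : γ = volume.withDensity (fun w => ENNReal.ofReal (ρ w)))
    {φ ψ : EuclideanSpace ℝ (Fin d) × EuclideanSpace ℝ (Fin d) → ℝ} (hφ : Continuous φ)
    (hψ : Continuous ψ) (h : φ =ᵐ[γ] ψ) : Set.EqOn φ ψ {w | 0 < ρ w} := by
  rw [hγ, EventuallyEq, ae_withDensity_iff hρ.measurable.ennreal_ofReal] at h
  have hopen : IsOpen {w | 0 < ρ w ∧ φ w ≠ ψ w} :=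
    (isOpen_lt continuous_const hρ).inter (isOpen_ne_fun hφ hψ)
  have hnull : volume {w | 0 < ρ w ∧ φ w ≠ ψ w} = 0 := by
    refine measure_mono_null ?_ h
    intro w hw
    simp only [Set.mem_compl_iff, Set.mem_ofPred_eq, not_forall] at hw ⊢
    exact ⟨(ENNReal.ofReal_pos.2 hw.1).ne', hw.2⟩
  intro w hw
  by_contra hne
  have : w ∈ {w | 0 < ρ w ∧ φ w ≠ ψ w} := ⟨hw, hne⟩
  rw [hopen.eq_empty_of_measure_zero hnull] at this
  exact this

variable [Nonempty (Fin n)] [Nonempty (Fin m)] [IsProbabilityMeasure γ]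

/-- The gradient vanishes at `z` and both values of `U` agree, so the integral of the nonnegative
linearization error from `z` to `z'` is zero, and the equality case holds almost everywhere. -/
theorem ae_maxAffine_add_eq_of_isMaxOn {K : ℝ} (hK0 : 0 ≤ K)
    (hK : ∀ (z : Dual n m) (s : ℝ), 0 ≤ s →
      ∫⁻ w in tieSet x y z s, ENNReal.ofReal (gaussWeight w) ∂γ ≤ ENNReal.ofReal (K * s))
    {a : Fin n → ℝ} {b : Fin m → ℝ} {z z' : Dual n m}
    (hz : IsMaxOn (dualObjective a x b y γ) Set.univ z)
    (hz' : IsMaxOn (dualObjective a x b y γ) Set.univ z') :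
    ∀ᵐ w ∂γ, maxAffine x (fstPart z') w.1 + maxAffine y (sndPart z') w.2 =
      maxAffine x (fstPart z) w.1 + maxAffine y (sndPart z) w.2 := by
  have h1 := dualObjective_add (x := x) (y := y) (γ := γ) a b z (z' - z)
  rw [dualGradient_eq_zero_of_isMaxOn (hasGradientAt_dualObjective hK0 hK a b z) hz,
    inner_zero_left, add_sub_cancel] at h1
  have h2 : dualObjective a x b y γ z ≤ dualObjective a x b y γ z' := hz' (Set.mem_univ z)
  have h3 : dualObjective a x b y γ z' ≤ dualObjective a x b y γ z := hz (Set.mem_univ z')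
  have h4 : ∫ w, weightError x y z (z' - z) w ∂γ = 0 := by linarith
  rw [integral_eq_zero_iff_of_nonneg_ae (weightError_nonneg hK z _)
    (integrable_weightError z _)] at h4
  filter_upwards [h4, measure_tieSet_zero hK z] with w hw hw'
  have := (weight_add_sub_nonneg z (z' - z) hw').2 hw
  rwa [add_sub_cancel] at this

-- At a critical point the cell carries weighted mass `a i > 0`, so it cannot miss `{ρ > 0}`.
omit [Nonempty (Fin n)] [Nonempty (Fin m)] [IsProbabilityMeasure γ] in
theorem exists_pos_mem_cell_fst
    {ρ : EuclideanSpace ℝ (Fin d) × EuclideanSpace ℝ (Fin d) → ℝ} (hρ : Measurable ρ)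
    (hγ : γ = volume.withDensity (fun w => ENNReal.ofReal (ρ w)))
    {a : Fin n → ℝ} {b : Fin m → ℝ} (ha_pos : ∀ i, 0 < a i) {z : Dual n m}
    (hz : dualGradient a x b y γ z = 0) (i : Fin n) :
    ∃ w, 0 < ρ w ∧ w.1 ∈ laguerreCell x (fstPart z) i := by
  by_contra! h
  have h1 : dualGradient a x b y γ z (Sum.inl i) = 0 := by rw [hz]; rfl
  have h2 : ∫ w in laguerreCell x (fstPart z) i ×ˢ Set.univ, weight x y z w ∂γ = 0 := by
    refine setIntegral_measure_zero _ (measure_eq_zero_iff_ae_notMem.2 ?_)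
    filter_upwards [ae_mem_of_withDensity hρ hγ] with w hw hmem using h w hw hmem.1
  simp only [dualGradient, Sum.elim_inl, h2, sub_zero] at h1
  exact (ha_pos i).ne' h1

omit [Nonempty (Fin n)] [Nonempty (Fin m)] [IsProbabilityMeasure γ] in
theorem exists_pos_mem_cell_snd
    {ρ : EuclideanSpace ℝ (Fin d) × EuclideanSpace ℝ (Fin d) → ℝ} (hρ : Measurable ρ)
    (hγ : γ = volume.withDensity (fun w => ENNReal.ofReal (ρ w)))
    {a : Fin n → ℝ} {b : Fin m → ℝ} (hb_pos : ∀ j, 0 < b j) {z : Dual n m}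
    (hz : dualGradient a x b y γ z = 0) (j : Fin m) :
    ∃ w, 0 < ρ w ∧ w.2 ∈ laguerreCell y (sndPart z) j := by
  by_contra! h
  have h1 : dualGradient a x b y γ z (Sum.inr j) = 0 := by rw [hz]; rfl
  have h2 : ∫ w in Set.univ ×ˢ laguerreCell y (sndPart z) j, weight x y z w ∂γ = 0 := by
    refine setIntegral_measure_zero _ (measure_eq_zero_iff_ae_notMem.2 ?_)
    filter_upwards [ae_mem_of_withDensity hρ hγ] with w hw hmem using h w hw hmem.2
  simp only [dualGradient, Sum.elim_inr, h2, sub_zero] at h1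
  exact (hb_pos j).ne' h1

omit [Nonempty (Fin n)] [Nonempty (Fin m)] in
theorem add_le_of_maxAffine_eq {p : Fin n → EuclideanSpace ℝ (Fin d)} {c c' : Fin n → ℝ} {r : ℝ}
    {u : EuclideanSpace ℝ (Fin d)} (h : maxAffine p c u = maxAffine p c' u + r) {i : Fin n}
    (hu : u ∈ laguerreCell p c i) : c' i + r ≤ c i := by
  have h1 : maxAffine p c u = inner ℝ u (p i) + c i := hu
  have h2 := le_maxAffine p c' u i
  linarith

theorem shiftEquiv_of_isMaxOn {K : ℝ} (hK0 : 0 ≤ K)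
    (hK : ∀ (z : Dual n m) (s : ℝ), 0 ≤ s →
      ∫⁻ w in tieSet x y z s, ENNReal.ofReal (gaussWeight w) ∂γ ≤ ENNReal.ofReal (K * s))
    {ρ : EuclideanSpace ℝ (Fin d) × EuclideanSpace ℝ (Fin d) → ℝ} (hρ : Continuous ρ)
    (hγ : γ = volume.withDensity (fun w => ENNReal.ofReal (ρ w)))
    (hconn : IsConnected {w | 0 < ρ w})
    {a : Fin n → ℝ} {b : Fin m → ℝ} (ha_pos : ∀ i, 0 < a i) (hb_pos : ∀ j, 0 < b j)
    {z z' : Dual n m} (hz : IsMaxOn (dualObjective a x b y γ) Set.univ z)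
    (hz' : IsMaxOn (dualObjective a x b y γ) Set.univ z') : ShiftEquiv z z' := by
  have hcx : ∀ z : Dual n m, Continuous fun u => maxAffine x (fstPart z) u := fun z =>
    continuous_maxAffine x continuous_const continuous_id
  have hcy : ∀ z : Dual n m, Continuous fun u => maxAffine y (sndPart z) u := fun z =>
    continuous_maxAffine y continuous_const continuous_id
  have heq := eqOn_of_ae_eq_withDensity hρ hγ
    (((hcx z').comp continuous_fst).add ((hcy z').comp continuous_snd))
    (((hcx z).comp continuous_fst).add ((hcy z).comp continuous_snd))
    (ae_maxAffine_add_eq_of_isMaxOn hK0 hK hz hz')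
  obtain ⟨r, hr⟩ := exists_eq_const_of_fst_eq_snd (isOpen_lt continuous_const hρ) hconn
    (φ := fun u => maxAffine x (fstPart z) u - maxAffine x (fstPart z') u)
    (ψ := fun u => maxAffine y (sndPart z') u - maxAffine y (sndPart z) u) fun w hw => by
      have : maxAffine x (fstPart z') w.1 + maxAffine y (sndPart z') w.2 =
        maxAffine x (fstPart z) w.1 + maxAffine y (sndPart z) w.2 := heq hw
      linarith
  have hfst : ∀ w, 0 < ρ w → maxAffine x (fstPart z) w.1 = maxAffine x (fstPart z') w.1 + r :=
    fun w hw => by linarith [hr w hw]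
  have hsnd : ∀ w, 0 < ρ w → maxAffine y (sndPart z) w.2 = maxAffine y (sndPart z') w.2 - r :=
    fun w hw => by
      have : maxAffine x (fstPart z') w.1 + maxAffine y (sndPart z') w.2 =
        maxAffine x (fstPart z) w.1 + maxAffine y (sndPart z) w.2 := heq hw
      linarith [hfst w hw]
  have hg := dualGradient_eq_zero_of_isMaxOn (hasGradientAt_dualObjective hK0 hK a b z) hz
  have hg' := dualGradient_eq_zero_of_isMaxOn (hasGradientAt_dualObjective hK0 hK a b z') hz'
  -- Each upper bound is read off at a point in a cell of `z'`, each lower bound at a point in a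
  -- cell of `z`; hence both points must be critical.
  refine ⟨r, fun i => le_antisymm ?_ ?_, fun j => le_antisymm ?_ ?_⟩
  · obtain ⟨w, hw, hi⟩ := exists_pos_mem_cell_fst hρ.measurable hγ ha_pos hg' i
    have := add_le_of_maxAffine_eq (c' := fstPart z) (r := -r) (by linarith [hfst w hw]) hi
    linarith
  · obtain ⟨w, hw, hi⟩ := exists_pos_mem_cell_fst hρ.measurable hγ ha_pos hg i
    exact add_le_of_maxAffine_eq (hfst w hw) hi
  · obtain ⟨w, hw, hj⟩ := exists_pos_mem_cell_snd hρ.measurable hγ hb_pos hg' j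
    have := add_le_of_maxAffine_eq (c' := sndPart z) (r := r) (by linarith [hsnd w hw]) hj
    linarith
  · obtain ⟨w, hw, hj⟩ := exists_pos_mem_cell_snd hρ.measurable hγ hb_pos hg j
    have := add_le_of_maxAffine_eq (c' := sndPart z') (r := -r) (by linarith [hsnd w hw]) hj
    linarith

end Uniqueness

end RelaxedBridge

end

/-! ### The main theorem -/

theorem proposition5p1 {d n m : ℕ}
    (a : Fin n → ℝ) (x : Fin n → EuclideanSpace ℝ (Fin d))
    (b : Fin m → ℝ) (y : Fin m → EuclideanSpace ℝ (Fin d))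
    (ha_pos : ∀ i, 0 < a i) (ha_sum : ∑ i, a i = 1) (hx : Function.Injective x)
    (hb_pos : ∀ j, 0 < b j) (hb_sum : ∑ j, b j = 1) (hy : Function.Injective y)
    (γ : Measure (EuclideanSpace ℝ (Fin d) × EuclideanSpace ℝ (Fin d))) [IsProbabilityMeasure γ]
    (ρ : EuclideanSpace ℝ (Fin d) × EuclideanSpace ℝ (Fin d) → ℝ)
    (hρ_cont : Continuous ρ) (hρ_nonneg : ∀ w, 0 ≤ ρ w) (hρ_bdd : ∃ C, ∀ w, ρ w ≤ C)
    (hγ : γ = volume.withDensity (fun w => ENNReal.ofReal (ρ w))) :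
    -- the gradient of the dual objective is given by the explicit formula
    (∀ z : RelaxedBridge.Dual n m,
      HasGradientAt (RelaxedBridge.dualObjective a x b y γ)
        (RelaxedBridge.dualGradient a x b y γ z) z) ∧
    -- gradient ascent with small step size converges to a dual optimizer
    ∀ z₀ : RelaxedBridge.Dual n m, ∃ η₀ : ℝ, 0 < η₀ ∧ ∀ η : ℝ, 0 < η → η < η₀ →
      ∃ zlim : RelaxedBridge.Dual n m,
        Tendsto (RelaxedBridge.gradientAscent (RelaxedBridge.dualObjective a x b y γ) η z₀)
          atTop (𝓝 zlim) ∧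
        IsMaxOn (RelaxedBridge.dualObjective a x b y γ) Set.univ zlim ∧
        -- which is the only one up to equivalence if `{ρ > 0}` is connected
        (IsConnected {w | 0 < ρ w} → ∀ zopt : RelaxedBridge.Dual n m,
          IsMaxOn (RelaxedBridge.dualObjective a x b y γ) Set.univ zopt →
          RelaxedBridge.ShiftEquiv zlim zopt) := by
  have : Nonempty (Fin n) := by
    by_contra h
    rw [not_nonempty_iff] at h
    simp at ha_sum
  have : Nonempty (Fin m) := by
    by_contra h
    rw [not_nonempty_iff] at h
    simp at hb_sum
  obtain ⟨K, hK0, hK⟩ :=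
    RelaxedBridge.exists_setLIntegral_tieSet_le hρ_cont.measurable hρ_bdd hγ hx hy
  have hgrad := RelaxedBridge.hasGradientAt_dualObjective hK0 hK a b
  refine ⟨hgrad, fun z₀ => ?_⟩
  have hadd := RelaxedBridge.dualObjective_add (x := x) (y := y) (γ := γ) a b
  obtain ⟨η₀, hη₀, H⟩ := RelaxedBridge.exists_tendsto_gradientDescent
    (F := fun z => -RelaxedBridge.dualObjective a x b y γ z)
    (G := fun z => -RelaxedBridge.dualGradient a x b y γ z)
    (e := RelaxedBridge.shiftVector n m)
    (continuous_iff_continuousAt.2 fun z => (hgrad z).continuousAt.neg)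
    (fun z h => by
      have h0 := integral_nonneg_of_ae (RelaxedBridge.weightError_nonneg hK z h)
      rw [hadd, inner_neg_left]
      linarith)
    (fun R => by
      obtain ⟨L, hL⟩ := RelaxedBridge.exists_abs_integral_weightError_le hK0 hK R
      refine ⟨L, fun z h hz hh => ?_⟩
      have h0 := (le_abs_self _).trans (hL z h hz hh)
      rw [hadd, inner_neg_left]
      linarith)
    (fun z => by
      rw [inner_neg_right, RelaxedBridge.inner_shiftVector_dualGradient hK ha_sum hb_sum, neg_zero])
    (RelaxedBridge.isBounded_superlevel ha_pos ha_sum hb_pos hb_sum) z₀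
  refine ⟨η₀, hη₀, fun η hη hlt => ?_⟩
  obtain ⟨zl, hzl, hmin⟩ := H η hη hlt
    (RelaxedBridge.gradientAscent (RelaxedBridge.dualObjective a x b y γ) η z₀) rfl fun t => by
      rw [smul_neg, sub_neg_eq_add, ← (hgrad _).gradient]; rfl
  have hmax : IsMaxOn (RelaxedBridge.dualObjective a x b y γ) Set.univ zl := fun z _ =>
    neg_le_neg_iff.1 (hmin z)
  exact ⟨zl, hzl, hmax, fun hconn zopt hopt =>
    RelaxedBridge.shiftEquiv_of_isMaxOn hK0 hK hρ_cont hγ hconn ha_pos hb_pos hmax hopt⟩
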